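/- Notation. $\langle\xi\rangle=(1+|\xi|^2)^{1/2}$ and $\mathcal F v(\xi)=\int e^{-ix\cdot\xi}v(x)\,dx$, extended to compactly supported distributions. $\mathcal D'(\mathbb R^n)$ is the space of complex-valued distributions with the strong topology. A cone is a set invariant under multiplication by positive reals, and a subset $L$ of $\mathbb R^n\times(\mathbb R^n\setminus\{0\})$ is conic if $(x,\xi)\in L$ implies $(x,t\xi)\in L$ for all $t>0$. For $r\in\mathbb R$, $u\in\mathcal D'(\mathbb R^n)$, a test function $\varphi\in\mathcal D(\mathbb R^n)$ and a cone $V\subseteq\mathbb R^n$, put $$\mathfrak p_{r;\varphi,V}(u)=\Big(\int_V|\mathcal F(\varphi u)(\xi)|^2\langle\xi\rangle^{2r}\,d\xi\Big)^{1/2}\in[0,\infty].$$ $H^r_{\mathrm{loc}}(\mathbb R^n)$ is the space of all $u\in\mathcal D'(\mathbb R^n)$ with $\mathfrak p_{r;\varphi,\mathbb R^n}(u)<\infty$ for every $\varphi\in\mathcal D(\mathbb R^n)$, with the topology given by these seminorms. The Sobolev wave front set $WF^r(u)\subseteq\mathbb R^n\times(\mathbb R^n\setminus\{0\})$ is defined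 as follows: $(x,\xi)\notin WF^r(u)$ if there are an open cone $V\ni\xi$ and $\varphi\in\mathcal D(\mathbb R^n)$ with $\varphi(x)\neq0$ and $\mathfrak p_{r;\varphi,V}(u)<\infty$. For a (relatively) closed conic subset $L$ of $\mathbb R^n\times(\mathbb R^n\setminus\{0\})$, $\mathcal D'^r_L(\mathbb R^n)=\{u\in\mathcal D'(\mathbb R^n): WF^r(u)\subseteq L\}$, with the topology given by all continuous seminorms on $\mathcal D'(\mathbb R^n)$ together with all $\mathfrak p_{r;\varphi,V}$ where $\varphi\in\mathcal D(\mathbb R^n)$ and $V$ is a closed cone in $\mathbb R^n$ with $(\operatorname{supp}\varphi\times V)\cap L=\emptyset$. For a smooth map $f:\mathbb R^m\to\mathbb R^n$, put $\mathcal N_f=\{(f(x),\eta): x\in\mathbb R^m,\ {}^tf'(x)\eta=0\}$, $f^*L=\{(x,{}^tf'(x)\eta): (f(x),\eta)\in L\}$, and $f^*g=g\circ f$ for $g\in\mathcal C^\infty(\mathbb R^n)$. Smooth functions are identified with the distributions that they define. Proposition. Let $n,m,k$ be positive integers with $k\le m$ and $k<n$, and let $$f:\mathbb R^m\to\mathbb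 R^n,\qquad f(x_1,\dots,x_m)=(x_1,\dots,x_k,0,\dots,0).$$ (i) For every real $r_2<(n-k)/2$, the map $f^*:\mathcal C^\infty(\mathbb R^n)\to\mathcal C^\infty(\mathbb R^m)$ does not extend to a continuous mapping $H^{r_2}_{\mathrm{loc}}(\mathbb R^n)\to\mathcal D'(\mathbb R^m)$. (ii) Let $r_1,r_2\in\mathbb R$ with $r_2-r_1<(n-k)/2$, and let $\widetilde L$ be a closed conic subset of $\mathbb R^m\times(\mathbb R^m\setminus\{0\})$ such that $$\Big(\{0_m\}\times\big((\mathbb R^k\times\{0_{m-k}\})\setminus\{0_m\}\big)\Big)\setminus\widetilde L\neq\emptyset .$$ Then $f^*:\mathcal C^\infty(\mathbb R^n)\to\mathcal C^\infty(\mathbb R^m)$ does not extend to a continuous mapping $H^{r_2}_{\mathrm{loc}}(\mathbb R^n)\to\mathcal D'^{r_1}_{\widetilde L}(\mathbb R^m)$. In particular, let $r_1,r_2\in\mathbb R$ with $r_2-r_1<(n-k)/2$, and let $L$ be a closed conic subset of $\mathbb R^n\times(\mathbb R^n\setminus\{0\})$ such that $L\cap\mathcal N_f=\emptyset$ and $\big(\{0_n\}\times(\{\eta_0'\}\times\mathbb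 R^{n-k})\big)\cap L=\emptyset$ for some $\eta_0'\in\mathbb R^k\setminus\{0\}$. Then $f^*$ does not extend to a continuous mapping $\mathcal D'^{r_2}_L(\mathbb R^n)\to\mathcal D'^{r_1}_{f^*L}(\mathbb R^m)$. -/

import Mathlib

open MeasureTheory TopologicalSpace
open scoped ContDiff

namespace SobolevPullback

noncomputable section

/-- The Euclidean space `ℝⁿ`. -/
abbrev Eu (n : ℕ) : Type := EuclideanSpace ℝ (Fin n)

/-- Complex-valued test functions on `ℝⁿ`. -/
abbrev Test (n : ℕ) : Type := TestFunction (⊤ : Opens (Eu n)) ℂ ⊤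

/-- Complex-valued distributions on `ℝⁿ`, with Mathlib's topology of uniform convergence on compact
sets of test functions, which is the strong dual topology since the space of test functions is
Montel. -/
abbrev Distr (n : ℕ) : Type := Distribution (⊤ : Opens (Eu n)) ℂ ⊤

variable {n m : ℕ}

/-- The value `⟨u, φ⟩` on a complex test function. Mathlib's distributions act on real test
functions; this is the `ℂ`-linear extension. -/
def pairing (u : Distr n) (φ : Test n) : ℂ :=
  u (TestFunction.postcompCLM Complex.reCLM φ) +
    Complex.I * u (TestFunction.postcompCLM Complex.imCLM φ)

/-- The test function `x ↦ exp (-i x·ξ) φ(x)`. -/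
def modulate (φ : Test n) (ξ : Eu n) : Test n where
  toFun x := Complex.exp (-Complex.I * (inner ℝ x ξ : ℝ)) * φ x
  contDiff' := by
    have h1 : ContDiff ℝ ∞ fun x : Eu n => Complex.exp (-Complex.I * (inner ℝ x ξ : ℝ)) :=
      (contDiff_const.mul
        (Complex.ofRealCLM.contDiff.comp (contDiff_id.inner ℝ contDiff_const))).cexp
    exact h1.mul φ.contDiff
  hasCompactSupport' := φ.hasCompactSupport.mul_left
  tsupport_subset' := fun _ _ => trivial

/-- The Fourier transform `𝓕(φu)(ξ) = ⟨u, φ exp (-i ⬝·ξ)⟩` of the compactly supported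
distribution `φu`. -/
def fourierLoc (u : Distr n) (φ : Test n) (ξ : Eu n) : ℂ := pairing u (modulate φ ξ)

/-- `𝔭_{r;φ,V}(u) = (∫_V |𝓕(φu)(ξ)|² ⟨ξ⟩^{2r} dξ)^{1/2}`, with values in `[0, ∞]`. -/
def locSeminorm (r : ℝ) (φ : Test n) (V : Set (Eu n)) (u : Distr n) : ENNReal :=
  (∫⁻ ξ in V, ‖fourierLoc u φ ξ‖ₑ ^ 2 * ENNReal.ofReal ((1 + ‖ξ‖ ^ 2) ^ r)) ^ (1 / 2 : ℝ)

/-- Cones are invariant under multiplication by positive reals. -/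
def IsCone (V : Set (Eu n)) : Prop := ∀ t : ℝ, 0 < t → ∀ ξ ∈ V, t • ξ ∈ V

/-- Closed conic subsets of `ℝⁿ × (ℝⁿ \ {0})`. -/
structure IsClosedConic (L : Set (Eu n × Eu n)) : Prop where
  snd_ne_zero : ∀ p ∈ L, p.2 ≠ 0
  conic : ∀ t : ℝ, 0 < t → ∀ x ξ : Eu n, (x, ξ) ∈ L → (x, t • ξ) ∈ L
  closed : IsClosed ((↑) ⁻¹' L : Set {p : Eu n × Eu n // p.2 ≠ 0})

/-- The local Sobolev space `H^r_loc(ℝⁿ)`: all `u` such that `φu ∈ H^r(ℝⁿ)` for each test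
function `φ`. -/
structure HLoc (n : ℕ) (r : ℝ) : Type where
  toDistr : Distr n
  finite : ∀ φ : Test n, locSeminorm r φ Set.univ toDistr < ⊤

/-- The topology of `H^r_loc(ℝⁿ)` defined by the seminorms `u ↦ ‖φu‖_{H^r}`: it is generated by
the balls of these seminorms. -/
instance (r : ℝ) : TopologicalSpace (HLoc n r) :=
  generateFrom {s | ∃ (φ : Test n) (u : HLoc n r) (ε : ENNReal), 0 < ε ∧
    s = {v | locSeminorm r φ Set.univ (v.toDistr - u.toDistr) < ε}}

/-- The Sobolev wave front set `WF^r(u)`. -/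
def WFSob (r : ℝ) (u : Distr n) : Set (Eu n × Eu n) :=
  {p | p.2 ≠ 0 ∧ ¬ ∃ (V : Set (Eu n)) (φ : Test n),
    IsOpen V ∧ IsCone V ∧ p.2 ∈ V ∧ φ p.1 ≠ 0 ∧ locSeminorm r φ V u < ⊤}

/-- The space of all distributions `u` on `ℝⁿ` with `WF^r(u) ⊆ L`. -/
structure DSob (n : ℕ) (r : ℝ) (L : Set (Eu n × Eu n)) : Type where
  toDistr : Distr n
  wf_subset : WFSob r toDistr ⊆ L

/-- The topology defined by all continuous seminorms on the space of distributions together with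
all seminorms `𝔭_{r;φ,V}`, where `V` is a closed cone and `(supp φ × V) ∩ L = ∅`: it is the
coarsest common refinement of the topology induced by the space of distributions and the topology
generated by the balls of the `𝔭_{r;φ,V}`. -/
instance (r : ℝ) (L : Set (Eu n × Eu n)) : TopologicalSpace (DSob n r L) :=
  TopologicalSpace.induced DSob.toDistr inferInstance ⊓
  generateFrom {s | ∃ (φ : Test n) (V : Set (Eu n)) (u : DSob n r L) (ε : ENNReal),
    IsClosed V ∧ IsCone V ∧ (tsupport φ ×ˢ V) ∩ L = ∅ ∧ 0 < ε ∧
    s = {v | locSeminorm r φ V (v.toDistr - u.toDistr) < ε}}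

/-- The distribution `φ ↦ ∫ φ g` given by a (continuous) function `g`. -/
def ofFun (g : Eu n → ℂ) : Distr n :=
  TestFunction.integralAgainstBilinCLM (ContinuousLinearMap.lsmul ℝ ℝ) volume g

/-- The set of normals `{(f(x), η) | ᵗf'(x) η = 0}` of a map. -/
def normals (f : Eu m → Eu n) : Set (Eu n × Eu n) :=
  {p | ∃ x, p.1 = f x ∧ ContinuousLinearMap.adjoint (fderiv ℝ f x) p.2 = 0}

/-- The pullback `{(x, ᵗf'(x) η) | (f(x), η) ∈ L}` of a conic set. -/
def pullbackSet (f : Eu m → Eu n) (L : Set (Eu n × Eu n)) : Set (Eu m × Eu m) :=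
  {p | ∃ η, (f p.1, η) ∈ L ∧ p.2 = ContinuousLinearMap.adjoint (fderiv ℝ f p.1) η}

/-- For spaces of distributions `i : X → 𝒟'(ℝⁿ)` and `j : Y → 𝒟'(ℝᵐ)`: the pullback `g ↦ g ∘ f` of
smooth functions extends to a continuous mapping `X → Y`. Linearity is not demanded. -/
def PullbackExtends (f : Eu m → Eu n) {X Y : Type} [TopologicalSpace X] [TopologicalSpace Y]
    (i : X → Distr n) (j : Y → Distr m) : Prop :=
  ∃ T : X → Y, Continuous T ∧ ∀ g : Eu n → ℂ, ContDiff ℝ ∞ g →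
    ∀ u : X, i u = ofFun g → j (T u) = ofFun (g ∘ f)

/-- The linear map `(x₁, …, x_m) ↦ (x₁, …, x_k, 0, …, 0)` from `ℝᵐ` to `ℝⁿ`. -/
def stdMap (n : ℕ) {m k : ℕ} (hkm : k ≤ m) (x : Eu m) : Eu n :=
  WithLp.toLp 2 fun i : Fin n => if h : (i : ℕ) < k then x ⟨i, h.trans_le hkm⟩ else 0

end

end SobolevPullback

namespace SobolevPullback

noncomputable section

/-! The map sees only the first `k` coordinates, so frequencies transverse to its range are lost
under pullback. A function can therefore be spread over many transverse frequencies, and so be small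
in Sobolev norm, while its pullback stays a single plane wave.

Concretely, `packet k a η J` is `J ^ a` times the mean of the `J ^ (n - k)` waves with frequencies
`J η + θ`, where `θ` runs over the lattice box `{0}ᵏ × [0, J)ⁿ⁻ᵏ` and `η` lies in the first `k`
coordinates. On the range of the map all these waves coincide, so the pullback is `J ^ a` times one
wave (`packet_comp_stdMap`). After multiplication by a test function, waves at distinct lattice
points are almost orthogonal (`exists_lintegral_packet_le`), so the squared `H^r` norm is at most of
order `J ^ (2a) * J ^ (-2(n-k)) * J ^ (n-k) * J ^ (2r)`. This tends to zero exactly when `a + r < (n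
- k) / 2` (`tendsto_locSeminorm_packet`).

With `a = -r₁` and `η ≠ 0` the pulled-back wave keeps a seminorm of order `r₁` bounded below in a
cone around its direction (`exists_le_locSeminorm_wave`), which contradicts continuity at zero. With
`a = 0` and `η = 0` the pullback is the constant `1`, which does not tend to zero even as a
distribution. For the source `𝒟'^r_L` the packets must also tend to zero in `𝒟'`; they do so by
rapid decay of Fourier transforms (`tendsto_ofFun_packet`). -/

open Filter Topology SchwartzMap FourierTransform Distributions

/-! ### Rapid decay of Fourier transforms of test functions -/

section Schwartz

variable {E F : Type*} [NormedAddCommGroup E] [NormedSpace ℝ E] [NormedAddCommGroup F]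
  [NormedSpace ℝ F]

/-- The continuous inclusion of the test functions into the Schwartz space. -/
def toSchwartzCLM (Ω : Opens E) : TestFunction Ω F ⊤ →L[ℝ] 𝓢(E, F) :=
  TestFunction.mkCLM ℝ (fun φ => φ.hasCompactSupport.toSchwartzMap φ.contDiff)
    (fun _ _ => rfl) (fun _ _ => rfl) fun K hK => by
      let A : ContDiffMapSupportedIn E F ⊤ K →ₗ[ℝ] 𝓢(E, F) :=
        { toFun := fun f => f.hasCompactSupport.toSchwartzMap f.contDiff
          map_add' := fun _ _ => rfl
          map_smul' := fun _ _ => rfl }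
      change Continuous A
      refine WithSeminorms.continuous_of_isBounded
        (ContDiffMapSupportedIn.withSeminorms ℝ E F ⊤ K) (schwartz_withSeminorms ℝ E F) _
        fun p => ?_
      obtain ⟨R, hR0, hR⟩ := K.isCompact.isBounded.exists_pos_norm_le
      refine ⟨{p.2}, ⟨R ^ p.1, by positivity⟩, fun f => ?_⟩
      rw [Finset.sup_singleton]
      refine SchwartzMap.seminorm_le_bound ℝ p.1 p.2 _ (mul_nonneg (NNReal.coe_nonneg _)
        (apply_nonneg _ _)) fun x => ?_
      by_cases hx : x ∈ K
      · exact mul_le_mul (pow_le_pow_left₀ (norm_nonneg _) (hR x hx) _)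
          (ContDiffMapSupportedIn.norm_iteratedFDeriv_apply_le_seminorm_top ℝ)
          (norm_nonneg _) (NNReal.coe_nonneg _)
      · have h0 : iteratedFDeriv ℝ p.2 (A f) x = 0 := f.iteratedFDeriv_zero_on_compl hx
        rw [h0, norm_zero, mul_zero]
        exact mul_nonneg (NNReal.coe_nonneg _) (apply_nonneg _ _)

end Schwartz

variable {n m : ℕ}

/-- The Fourier transform `∫ exp (-i x·ζ) φ(x) dx` of a test function. -/
def fhat (φ : Test n) (ζ : Eu n) : ℂ :=
  ∫ x, Complex.exp (-Complex.I * (inner ℝ x ζ : ℝ)) * φ x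

theorem fhat_eq_fourier (φ : Test n) (ζ : Eu n) :
    fhat φ ζ = 𝓕 (toSchwartzCLM ⊤ φ) ((2 * Real.pi)⁻¹ • ζ) := by
  rw [SchwartzMap.fourier_coe, Real.fourier_eq']
  refine integral_congr_ae (Eventually.of_forall fun x => ?_)
  have hpi : (Real.pi : ℂ) ≠ 0 := by exact_mod_cast Real.pi_ne_zero
  have h1 : -Complex.I * ((inner ℝ x ζ : ℝ) : ℂ) =
      ((-2 * Real.pi * inner ℝ x ((2 * Real.pi)⁻¹ • ζ) : ℝ) : ℂ) * Complex.I := by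
    rw [inner_smul_right]
    push_cast
    field_simp
  simp only [h1, smul_eq_mul]
  rfl

theorem continuous_fhat (φ : Test n) : Continuous (fhat φ) := by
  have : fhat φ = fun ζ => 𝓕 (toSchwartzCLM ⊤ φ) ((2 * Real.pi)⁻¹ • ζ) :=
    funext (fhat_eq_fourier φ)
  rw [this]
  exact (SchwartzMap.continuous _).comp (continuous_const_smul _)

/-- The Fourier transforms of a compact set of test functions decay rapidly, uniformly. -/
theorem exists_norm_fhat_le {K : Set (Test n)} (hK : IsCompact K) (M : ℕ) :
    ∃ C : ℝ, 0 < C ∧ ∀ φ ∈ K, ∀ ζ, ‖fhat φ ζ‖ ≤ C * ((1 + ‖ζ‖ ^ 2) ^ M)⁻¹ := by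
  let p : Seminorm ℝ 𝓢(Eu n, ℂ) :=
    (Finset.Iic (2 * M, 0)).sup (fun m : ℕ × ℕ => SchwartzMap.seminorm ℝ m.1 m.2)
  have hp : Continuous p := by
    refine Continuous.congr ?_ fun x => (Seminorm.finset_sup_apply _ _ x).symm
    exact NNReal.continuous_coe.comp (Continuous.finset_sup_apply fun i _ =>
      Continuous.subtype_mk ((schwartz_withSeminorms ℝ (Eu n) ℂ).continuous_seminorm i) _)
  -- A Schwartz seminorm of the Fourier transform is a continuous function on the test functions,
  -- hence bounded on `K`; this makes the decay uniform.
  have hq : Continuous fun φ : Test n => p (𝓕 (toSchwartzCLM ⊤ φ)) :=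
    hp.comp ((FourierTransform.continuous_fourier).comp (toSchwartzCLM ⊤).continuous)
  obtain ⟨C, hC⟩ := hK.bddAbove_image hq.continuousOn
  have hC' : ∀ φ ∈ K, p (𝓕 (toSchwartzCLM ⊤ φ)) ≤ |C| := fun φ hφ =>
    (hC ⟨φ, hφ, rfl⟩).trans (le_abs_self C)
  -- The powers of `2π` pay for the rescaling `y = ζ / 2π`, those of `2` come from the Schwartz
  -- bound, and `|C| + 1` ensures positivity.
  refine ⟨(2 * Real.pi) ^ (2 * M) * (2 ^ (2 * M) * (|C| + 1)), by positivity, fun φ hφ ζ => ?_⟩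
  set y : Eu n := (2 * Real.pi)⁻¹ • ζ with hy
  have h1 := SchwartzMap.one_add_le_sup_seminorm_apply (𝕜 := ℝ) (m := (2 * M, 0)) (k := 2 * M)
    (n := 0) le_rfl le_rfl (𝓕 (toSchwartzCLM ⊤ φ)) y
  rw [norm_iteratedFDeriv_zero, ← fhat_eq_fourier] at h1
  have h2 : (1 + ‖y‖) ^ (2 * M) * ‖fhat φ ζ‖ ≤ 2 ^ (2 * M) * (|C| + 1) := by
    refine h1.trans (mul_le_mul_of_nonneg_left ((hC' φ hφ).trans (by linarith)) (by positivity))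
  have hzy : ‖ζ‖ = 2 * Real.pi * ‖y‖ := by
    rw [hy, norm_smul, Real.norm_of_nonneg (by positivity)]
    field_simp
  have h3 : 1 + ‖ζ‖ ^ 2 ≤ (2 * Real.pi * (1 + ‖y‖)) ^ 2 := by
    have h2pi : 1 ≤ 2 * Real.pi := by linarith [Real.pi_gt_three]
    have : 1 + ‖ζ‖ ≤ 2 * Real.pi * (1 + ‖y‖) := by rw [hzy]; linarith
    calc 1 + ‖ζ‖ ^ 2 ≤ (1 + ‖ζ‖) ^ 2 := by nlinarith [norm_nonneg ζ]
      _ ≤ _ := by gcongr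
  rw [← div_eq_mul_inv, le_div_iff₀ (by positivity)]
  calc ‖fhat φ ζ‖ * (1 + ‖ζ‖ ^ 2) ^ M
      ≤ ‖fhat φ ζ‖ * ((2 * Real.pi * (1 + ‖y‖)) ^ 2) ^ M := by gcongr
    _ = (2 * Real.pi) ^ (2 * M) * ((1 + ‖y‖) ^ (2 * M) * ‖fhat φ ζ‖) := by
        rw [← pow_mul, mul_pow]; ring
    _ ≤ _ := by gcongr

/-! ### Plane waves as distributions -/

/-- The plane wave `x ↦ exp (i x·κ)`. -/
def wave (κ x : Eu n) : ℂ := Complex.exp (Complex.I * (inner ℝ x κ : ℝ))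

theorem contDiff_wave (κ : Eu n) : ContDiff ℝ ∞ (wave κ) :=
  (contDiff_const.mul
    (Complex.ofRealCLM.contDiff.comp (contDiff_id.inner ℝ contDiff_const))).cexp

theorem ofFun_apply {g : Eu n → ℂ} (hg : Continuous g) (ψ : TestFunction (⊤ : Opens (Eu n)) ℝ ⊤) :
    ofFun g ψ = ∫ x, (ψ x : ℂ) * g x := by
  refine (TestFunction.integralAgainstBilinCLM_eq_integral
    (hg.locallyIntegrable.locallyIntegrableOn _)).trans ?_
  simp

theorem ofFun_zero : ofFun (0 : Eu n → ℂ) = 0 := by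
  ext ψ
  rw [ofFun_apply continuous_zero]
  simp

theorem integrable_testFunction_mul {g : Eu n → ℂ} (hg : Continuous g) {φ : Eu n → ℂ}
    (hφ : Continuous φ) (hc : HasCompactSupport φ) : Integrable fun x => φ x * g x :=
  (hφ.mul hg).integrable_of_hasCompactSupport hc.mul_right

theorem pairing_ofFun {g : Eu n → ℂ} (hg : Continuous g) (φ : Test n) :
    pairing (ofFun g) φ = ∫ x, φ x * g x := by
  have hint : ∀ a : TestFunction (⊤ : Opens (Eu n)) ℝ ⊤, Integrable fun x => (a x : ℂ) * g x :=
    fun a => integrable_testFunction_mul hg (Complex.continuous_ofReal.comp a.continuous)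
      (a.hasCompactSupport.comp_left Complex.ofReal_zero)
  rw [pairing, ofFun_apply hg, ofFun_apply hg, ← integral_const_mul,
    ← integral_add (hint _) ((hint _).const_mul _)]
  refine integral_congr_ae (Eventually.of_forall fun x => ?_)
  change ((φ x).re : ℂ) * g x + Complex.I * (((φ x).im : ℂ) * g x) = φ x * g x
  conv_rhs => rw [← Complex.re_add_im (φ x)]
  ring

theorem fourierLoc_ofFun_wave_sum {ι : Type*} (S : Finset ι) (Θ : ι → Eu n) (c : ℂ) (φ : Test n)
    (ξ : Eu n) :
    fourierLoc (ofFun fun x => c * ∑ s ∈ S, wave (Θ s) x) φ ξ = c * ∑ s ∈ S, fhat φ (ξ - Θ s) := by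
  have hw : ∀ κ : Eu n, Continuous (wave κ) := fun κ => (contDiff_wave κ).continuous
  rw [fourierLoc, pairing_ofFun (by fun_prop), Finset.mul_sum]
  simp only [fhat, ← integral_const_mul]
  rw [← integral_finsetSum]
  · refine integral_congr_ae (Eventually.of_forall fun x => ?_)
    change Complex.exp (-Complex.I * (inner ℝ x ξ : ℝ)) * φ x * _ = _
    simp only [Finset.mul_sum]
    refine Finset.sum_congr rfl fun s _ => ?_
    rw [wave, inner_sub_right]
    push_cast
    rw [mul_sub, sub_eq_add_neg, Complex.exp_add]
    ring_nf
  · intro s _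
    refine Integrable.const_mul ?_ _
    exact (modulate φ (ξ - Θ s)).continuous.integrable_of_hasCompactSupport
      (modulate φ (ξ - Θ s)).hasCompactSupport

theorem ofFun_wave_sum_apply {ι : Type*} (S : Finset ι) (Θ : ι → Eu n) (c : ℂ)
    (ψ : TestFunction (⊤ : Opens (Eu n)) ℝ ⊤) :
    ofFun (fun x => c * ∑ s ∈ S, wave (Θ s) x) ψ =
      c * ∑ s ∈ S, fhat (TestFunction.postcompCLM Complex.ofRealCLM ψ) (-Θ s) := by
  have hw : ∀ κ : Eu n, Continuous (wave κ) := fun κ => (contDiff_wave κ).continuous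
  rw [ofFun_apply (by fun_prop), Finset.mul_sum]
  simp only [fhat, ← integral_const_mul]
  rw [← integral_finsetSum]
  · refine integral_congr_ae (Eventually.of_forall fun x => ?_)
    simp only [Finset.mul_sum]
    refine Finset.sum_congr rfl fun s _ => ?_
    simp only [wave, TestFunction.postcompCLM_apply, Function.comp, Complex.ofRealCLM_apply,
      inner_neg_right, Complex.ofReal_neg, neg_mul_neg]
    ring
  · intro s _
    refine Integrable.const_mul ?_ _
    exact (modulate _ (-Θ s)).continuous.integrable_of_hasCompactSupport
      (modulate (TestFunction.postcompCLM Complex.ofRealCLM ψ) (-Θ s)).hasCompactSupport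

theorem fourierLoc_sub (u v : Distr n) (φ : Test n) (ξ : Eu n) :
    fourierLoc (u - v) φ ξ = fourierLoc u φ ξ - fourierLoc v φ ξ := by
  have h : ∀ ψ, (u - v) ψ = u ψ - v ψ := fun _ => rfl
  simp only [fourierLoc, pairing, h]
  ring

theorem fourierLoc_zero (φ : Test n) (ξ : Eu n) : fourierLoc (0 : Distr n) φ ξ = 0 := by
  have h : ∀ ψ, (0 : Distr n) ψ = 0 := fun _ => rfl
  simp [fourierLoc, pairing, h]

/-! ### Lattice sums and almost orthogonality -/

/-- Replacing `x` by its floor costs a constant factor and turns the sum into part of a fixed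
convergent series over `ℤ`; hence the uniformity in `x` and `S`. -/
theorem exists_sum_inv_one_add_sq_le :
    ∃ B : ℝ, 0 ≤ B ∧ ∀ (x : ℝ) (S : Finset ℕ), ∑ l ∈ S, (1 + (x - l) ^ 2)⁻¹ ≤ B := by
  have hs : Summable fun z : ℤ => (1 + (z : ℝ) ^ 2)⁻¹ := by
    have h := Real.summable_one_div_int_pow (p := 2) |>.2 one_lt_two
    refine Summable.of_norm_bounded_eventually h ?_
    have h0 : {z : ℤ | z ≠ 0} ∈ (Filter.cofinite : Filter ℤ) :=
      (Set.finite_singleton (0 : ℤ)).compl_mem_cofinite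
    filter_upwards [h0] with z hz
    have hz' : (0 : ℝ) < (z : ℝ) ^ 2 := by positivity
    rw [Real.norm_of_nonneg (by positivity), one_div]
    exact inv_anti₀ hz' (by linarith)
  have h3 : Summable fun z : ℤ => 3 * (1 + (z : ℝ) ^ 2)⁻¹ := hs.mul_left 3
  refine ⟨∑' z : ℤ, 3 * (1 + (z : ℝ) ^ 2)⁻¹, tsum_nonneg fun z => by positivity, fun x S => ?_⟩
  have hinj : Function.Injective fun l : ℕ => ⌊x⌋ - (l : ℤ) := fun a b h => by
    simpa using h
  calc ∑ l ∈ S, (1 + (x - l) ^ 2)⁻¹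
      ≤ ∑ l ∈ S, 3 * (1 + ((⌊x⌋ - (l : ℤ) : ℤ) : ℝ) ^ 2)⁻¹ := by
        refine Finset.sum_le_sum fun l _ => ?_
        -- The factor `3` comes from `(a - b)² ≤ 2a² + 2b²` with `b` the fractional part of `x`, so
        -- `b² ≤ 1`.
        rw [← div_eq_mul_inv, inv_le_comm₀ (by positivity) (by positivity), inv_div]
        have h1 := Int.floor_le x
        have h2 := Int.lt_floor_add_one x
        push_cast
        have h4 : (x - ⌊x⌋) ^ 2 ≤ 1 := by nlinarith
        nlinarith [sq_nonneg ((x - l) + (x - ⌊x⌋))]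
    _ ≤ ∑' l : ℕ, 3 * (1 + ((⌊x⌋ - (l : ℤ) : ℤ) : ℝ) ^ 2)⁻¹ :=
        (h3.comp_injective hinj).sum_le_tsum S fun l _ => by positivity
    _ ≤ _ := tsum_comp_le_tsum_of_inj h3 (fun z => by positivity) hinj

/-- A vector of natural numbers as a point of `ℝⁿ`. -/
def natVec (θ : Fin n → ℕ) : Eu n := WithLp.toLp 2 fun i => (θ i : ℝ)

/-- The `n`-th power dominates the product over the coordinates of `1 + (ζ i - θ i)²`, and on a
product of finite sets the resulting sum factors into one-dimensional ones. -/
theorem exists_sum_lattice_le (n : ℕ) :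
    ∃ B : ℝ, 0 ≤ B ∧ ∀ (ζ : Eu n) (t : Fin n → Finset ℕ),
      ∑ θ ∈ Fintype.piFinset t, ((1 + ‖ζ - natVec θ‖ ^ 2) ^ n)⁻¹ ≤ B := by
  obtain ⟨B, hB0, hB⟩ := exists_sum_inv_one_add_sq_le
  refine ⟨B ^ n, by positivity, fun ζ t => ?_⟩
  calc ∑ θ ∈ Fintype.piFinset t, ((1 + ‖ζ - natVec θ‖ ^ 2) ^ n)⁻¹
      ≤ ∑ θ ∈ Fintype.piFinset t, ∏ i, (1 + (ζ i - θ i) ^ 2)⁻¹ := by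
        refine Finset.sum_le_sum fun θ _ => ?_
        rw [Finset.prod_inv_distrib]
        refine inv_anti₀ (Finset.prod_pos fun i _ => by positivity) ?_
        have h : ∏ i : Fin n, (1 + (ζ i - θ i) ^ 2) ≤
            ∏ _i : Fin n, (1 + ‖ζ - natVec θ‖ ^ 2) := by
          refine Finset.prod_le_prod (fun i _ => by positivity) fun i _ => ?_
          rw [EuclideanSpace.real_norm_sq_eq]
          have := Finset.single_le_sum (f := fun i => ((ζ - natVec θ) i) ^ 2)
            (fun i _ => sq_nonneg _) (Finset.mem_univ i)
          simp only [natVec, PiLp.sub_apply] at this ⊢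
          linarith
        simpa using h
    _ = ∏ i, ∑ l ∈ t i, (1 + (ζ i - l) ^ 2)⁻¹ :=
        (Finset.prod_univ_sum t fun i l => (1 + (ζ i - (l : ℝ)) ^ 2)⁻¹).symm
    _ ≤ ∏ _i : Fin n, B :=
        Finset.prod_le_prod (fun i _ => Finset.sum_nonneg fun l _ => by positivity)
          fun i _ => hB _ _
    _ = B ^ n := by simp

/-- Peetre's inequality. -/
theorem peetre {V : Type*} [NormedAddCommGroup V] (r : ℝ) (x y : V) :
    (1 + ‖x‖ ^ 2) ^ r ≤ 2 ^ |r| * (1 + ‖x - y‖ ^ 2) ^ |r| * (1 + ‖y‖ ^ 2) ^ r := by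
  have key : ∀ a b : V, 1 + ‖a‖ ^ 2 ≤ 2 * (1 + ‖a - b‖ ^ 2) * (1 + ‖b‖ ^ 2) := fun a b => by
    have h : ‖a‖ ≤ ‖a - b‖ + ‖b‖ := by simpa using norm_add_le (a - b) b
    have h2 : ‖a‖ ^ 2 ≤ (‖a - b‖ + ‖b‖) ^ 2 := by gcongr
    nlinarith [sq_nonneg (‖a - b‖ - ‖b‖), mul_nonneg (sq_nonneg ‖a - b‖) (sq_nonneg ‖b‖)]
  rcases le_total 0 r with hr | hr
  · rw [abs_of_nonneg hr, ← Real.mul_rpow (by positivity) (by positivity),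
      ← Real.mul_rpow (by positivity) (by positivity)]
    exact Real.rpow_le_rpow (by positivity) (key x y) hr
  · rw [abs_of_nonpos hr, ← Real.mul_rpow (by positivity) (by positivity)]
    have h := Real.rpow_le_rpow (by positivity) (key y x) (neg_nonneg.2 hr)
    rw [norm_sub_rev y x, Real.mul_rpow (by positivity) (by positivity)] at h
    have e1 : (1 + ‖x‖ ^ 2) ^ r * (1 + ‖x‖ ^ 2) ^ (-r) = 1 := by
      rw [← Real.rpow_add (by positivity)]; simp
    have e2 : (1 + ‖y‖ ^ 2) ^ r * (1 + ‖y‖ ^ 2) ^ (-r) = 1 := by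
      rw [← Real.rpow_add (by positivity)]; simp
    calc (1 + ‖x‖ ^ 2) ^ r
        = (1 + ‖x‖ ^ 2) ^ r * (1 + ‖y‖ ^ 2) ^ r * (1 + ‖y‖ ^ 2) ^ (-r) := by
          rw [mul_assoc, e2, mul_one]
      _ ≤ (1 + ‖x‖ ^ 2) ^ r * (1 + ‖y‖ ^ 2) ^ r *
          ((2 * (1 + ‖x - y‖ ^ 2)) ^ (-r) * (1 + ‖x‖ ^ 2) ^ (-r)) := by gcongr
      _ = ((1 + ‖x‖ ^ 2) ^ r * (1 + ‖x‖ ^ 2) ^ (-r)) *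
          ((2 * (1 + ‖x - y‖ ^ 2)) ^ (-r) * (1 + ‖y‖ ^ 2) ^ r) := by ring
      _ = _ := by rw [e1, one_mul]

/-- Peetre's inequality moves the weight from `ξ` to `Θ` at the price of a power of `1 + ‖ξ - Θ‖²`,
which the decay of `fhat φ` absorbs. -/
theorem exists_lintegral_fhat_shift_le (φ : Test n) (r : ℝ) :
    ∃ C : ℝ, 0 ≤ C ∧ ∀ Θ : Eu n,
      ∫⁻ ξ, ‖fhat φ (ξ - Θ)‖ₑ * ENNReal.ofReal ((1 + ‖ξ‖ ^ 2) ^ r) ≤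
        ENNReal.ofReal (C * (1 + ‖Θ‖ ^ 2) ^ r) := by
  -- Of the decay exponent, `|r|` is spent on Peetre's inequality and `(n + 1) / 2` is left for
  -- integrability.
  obtain ⟨M, hM⟩ := exists_nat_ge (|r| + (n + 1) / 2)
  obtain ⟨C, hC0, hC⟩ := exists_norm_fhat_le (isCompact_singleton (x := φ)) M
  have hint : Integrable (fun ζ : Eu n => (1 + ‖ζ‖ ^ 2) ^ (-((n : ℝ) + 1) / 2)) :=
    integrable_rpow_neg_one_add_norm_sq (by simp)
  set I := ∫ ζ : Eu n, (1 + ‖ζ‖ ^ 2) ^ (-((n : ℝ) + 1) / 2) with hI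
  have hI0 : 0 ≤ I := integral_nonneg fun ζ => by positivity
  refine ⟨C * 2 ^ |r| * I, by positivity, fun Θ => ?_⟩
  have hpt : ∀ ξ : Eu n, ‖fhat φ (ξ - Θ)‖ₑ * ENNReal.ofReal ((1 + ‖ξ‖ ^ 2) ^ r) ≤
      ENNReal.ofReal (C * 2 ^ |r| * (1 + ‖Θ‖ ^ 2) ^ r) *
        ENNReal.ofReal ((1 + ‖ξ - Θ‖ ^ 2) ^ (-((n : ℝ) + 1) / 2)) := fun ξ => by
    rw [← ofReal_norm, ← ENNReal.ofReal_mul (norm_nonneg _),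
      ← ENNReal.ofReal_mul (by positivity)]
    refine ENNReal.ofReal_le_ofReal ?_
    set D := 1 + ‖ξ - Θ‖ ^ 2 with hD
    have hD1 : 1 ≤ D := by rw [hD]; nlinarith [sq_nonneg ‖ξ - Θ‖]
    have hD0 : 0 < D := by linarith
    have h1 : (D ^ M)⁻¹ * D ^ |r| ≤ D ^ (-((n : ℝ) + 1) / 2) := by
      rw [← Real.rpow_natCast, ← Real.rpow_neg hD0.le, ← Real.rpow_add hD0]
      exact Real.rpow_le_rpow_of_exponent_le hD1 (by linarith)
    calc ‖fhat φ (ξ - Θ)‖ * (1 + ‖ξ‖ ^ 2) ^ r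
        ≤ (C * (D ^ M)⁻¹) * (2 ^ |r| * D ^ |r| * (1 + ‖Θ‖ ^ 2) ^ r) := by
          gcongr
          · exact hC φ rfl _
          · exact peetre r ξ Θ
      _ = C * 2 ^ |r| * (1 + ‖Θ‖ ^ 2) ^ r * ((D ^ M)⁻¹ * D ^ |r|) := by ring
      _ ≤ _ := by gcongr
  calc ∫⁻ ξ, ‖fhat φ (ξ - Θ)‖ₑ * ENNReal.ofReal ((1 + ‖ξ‖ ^ 2) ^ r)
      ≤ ∫⁻ ξ, ENNReal.ofReal (C * 2 ^ |r| * (1 + ‖Θ‖ ^ 2) ^ r) *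
        ENNReal.ofReal ((1 + ‖ξ - Θ‖ ^ 2) ^ (-((n : ℝ) + 1) / 2)) := lintegral_mono hpt
    _ = ENNReal.ofReal (C * 2 ^ |r| * (1 + ‖Θ‖ ^ 2) ^ r) *
        ∫⁻ ζ : Eu n, ENNReal.ofReal ((1 + ‖ζ‖ ^ 2) ^ (-((n : ℝ) + 1) / 2)) := by
        rw [lintegral_const_mul' _ _ ENNReal.ofReal_ne_top,
          lintegral_sub_right_eq_self
            (fun ζ : Eu n => ENNReal.ofReal ((1 + ‖ζ‖ ^ 2) ^ (-((n : ℝ) + 1) / 2))) Θ]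
    _ = ENNReal.ofReal (C * 2 ^ |r| * I * (1 + ‖Θ‖ ^ 2) ^ r) := by
        rw [← ofReal_integral_eq_lintegral_ofReal hint
          (Eventually.of_forall fun ζ => by positivity), ← ENNReal.ofReal_mul (by positivity)]
        congr 1
        rw [← hI]
        ring
    _ ≤ _ := le_rfl

/-- The weighted norm of a superposition of plane waves on a lattice box is almost orthogonal. -/
theorem exists_lintegral_packet_le (φ : Test n) (r : ℝ) :
    ∃ C : ℝ, 0 ≤ C ∧ ∀ (v : Eu n) (t : Fin n → Finset ℕ) (c : ℂ),
      ∫⁻ ξ, ‖c * ∑ θ ∈ Fintype.piFinset t, fhat φ (ξ - (v + natVec θ))‖ₑ ^ 2 *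
          ENNReal.ofReal ((1 + ‖ξ‖ ^ 2) ^ r) ≤
        ENNReal.ofReal
          (C * ‖c‖ ^ 2 * ∑ θ ∈ Fintype.piFinset t, (1 + ‖v + natVec θ‖ ^ 2) ^ r) := by
  obtain ⟨A, hA0, hA⟩ := exists_norm_fhat_le (isCompact_singleton (x := φ)) n
  obtain ⟨B, hB0, hB⟩ := exists_sum_lattice_le n
  obtain ⟨C, hC0, hC⟩ := exists_lintegral_fhat_shift_le φ r
  refine ⟨A * B * C, by positivity, fun v t c => ?_⟩
  set S := Fintype.piFinset t with hS
  -- One factor of the squared sum is bounded uniformly in the box, which leaves a single sum: the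
  -- cross terms cost only a constant.
  have hsum : ∀ ξ : Eu n, ∑ θ ∈ S, ‖fhat φ (ξ - (v + natVec θ))‖ₑ ≤ ENNReal.ofReal (A * B) := by
    intro ξ
    simp_rw [← ofReal_norm]
    rw [← ENNReal.ofReal_sum_of_nonneg fun _ _ => norm_nonneg _]
    refine ENNReal.ofReal_le_ofReal ?_
    calc ∑ θ ∈ S, ‖fhat φ (ξ - (v + natVec θ))‖
        ≤ ∑ θ ∈ S, A * ((1 + ‖(ξ - v) - natVec θ‖ ^ 2) ^ n)⁻¹ :=
          Finset.sum_le_sum fun θ _ => by rw [sub_sub]; exact hA φ rfl _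
      _ ≤ A * B := by rw [← Finset.mul_sum]; gcongr; exact hB _ _
  have hpt : ∀ ξ : Eu n, ‖c * ∑ θ ∈ S, fhat φ (ξ - (v + natVec θ))‖ₑ ^ 2 *
      ENNReal.ofReal ((1 + ‖ξ‖ ^ 2) ^ r) ≤ ‖c‖ₑ ^ 2 * ENNReal.ofReal (A * B) *
        ∑ θ ∈ S, ‖fhat φ (ξ - (v + natVec θ))‖ₑ * ENNReal.ofReal ((1 + ‖ξ‖ ^ 2) ^ r) := by
    intro ξ
    rw [enorm_mul, mul_pow, ← Finset.sum_mul, sq (‖∑ θ ∈ S, _‖ₑ)]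
    have h1 := enorm_sum_le S fun θ => fhat φ (ξ - (v + natVec θ))
    calc ‖c‖ₑ ^ 2 * (_ * _) * _
        ≤ ‖c‖ₑ ^ 2 * (ENNReal.ofReal (A * B) * ∑ θ ∈ S, ‖fhat φ (ξ - (v + natVec θ))‖ₑ) *
          ENNReal.ofReal ((1 + ‖ξ‖ ^ 2) ^ r) := by
          gcongr
          exact h1.trans (hsum ξ)
      _ = _ := by ring
  have hmeas : ∀ θ ∈ S, Measurable fun ξ : Eu n =>
      ‖fhat φ (ξ - (v + natVec θ))‖ₑ * ENNReal.ofReal ((1 + ‖ξ‖ ^ 2) ^ r) := fun θ _ => by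
    have := (continuous_fhat φ).comp (continuous_id.sub (continuous_const (y := v + natVec θ)))
    exact this.enorm.measurable.mul (by fun_prop)
  calc _ ≤ ∫⁻ ξ, ‖c‖ₑ ^ 2 * ENNReal.ofReal (A * B) *
        ∑ θ ∈ S, ‖fhat φ (ξ - (v + natVec θ))‖ₑ * ENNReal.ofReal ((1 + ‖ξ‖ ^ 2) ^ r) :=
        lintegral_mono hpt
    _ = ‖c‖ₑ ^ 2 * ENNReal.ofReal (A * B) * ∑ θ ∈ S,
        ∫⁻ ξ, ‖fhat φ (ξ - (v + natVec θ))‖ₑ * ENNReal.ofReal ((1 + ‖ξ‖ ^ 2) ^ r) := by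
        rw [lintegral_const_mul' _ _ (by finiteness), lintegral_finsetSum S hmeas]
    _ ≤ ‖c‖ₑ ^ 2 * ENNReal.ofReal (A * B) * ∑ θ ∈ S,
        ENNReal.ofReal (C * (1 + ‖v + natVec θ‖ ^ 2) ^ r) := by
        gcongr
        exact hC _
    _ = _ := by
        rw [← ENNReal.ofReal_sum_of_nonneg fun _ _ => by positivity, ← ofReal_norm,
          ← ENNReal.ofReal_pow (norm_nonneg _), ← ENNReal.ofReal_mul (by positivity),
          ← ENNReal.ofReal_mul (by positivity), ← Finset.mul_sum]
        congr 1
        ring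

/-! ### Packets: norms, convergence and pullback -/

/-- The lattice points of `{0}ᵏ × [0, J)ⁿ⁻ᵏ`. -/
def box (n k J : ℕ) : Finset (Fin n → ℕ) :=
  Fintype.piFinset fun i => if (i : ℕ) < k then {0} else Finset.range J

theorem card_box {n k : ℕ} (hkn : k ≤ n) (J : ℕ) : (box n k J).card = J ^ (n - k) := by
  have h : ∀ i : Fin n, (if (i : ℕ) < k then ({0} : Finset ℕ) else Finset.range J).card =
      if (i : ℕ) < k then 1 else J := fun i => by split_ifs <;> simp
  rw [box, Fintype.card_piFinset, Finset.prod_congr rfl fun i _ => h i,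
    Fin.prod_univ_eq_prod_range (fun i => if i < k then 1 else J) n]
  obtain ⟨d, rfl⟩ := Nat.exists_eq_add_of_le hkn
  rw [Finset.prod_range_add, Finset.prod_congr rfl fun i hi => if_pos (Finset.mem_range.1 hi)]
  simp

theorem mem_box_zero {n k J : ℕ} {θ : Fin n → ℕ} (hθ : θ ∈ box n k J) {i : Fin n}
    (hi : (i : ℕ) < k) : θ i = 0 := by
  have := Fintype.mem_piFinset.1 hθ i
  simpa [hi] using this

theorem mem_box_le {n k J : ℕ} {θ : Fin n → ℕ} (hθ : θ ∈ box n k J) (i : Fin n) : θ i ≤ J := by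
  have := Fintype.mem_piFinset.1 hθ i
  split_ifs at this with h
  · simp [Finset.mem_singleton.1 this]
  · exact (Finset.mem_range.1 this).le

/-- `η` and `θ` have complementary supports, so their squared norms add. -/
theorem freq_bounds {k J : ℕ} {η : Eu n} (hη : ∀ i : Fin n, k ≤ (i : ℕ) → η i = 0)
    {θ : Fin n → ℕ} (hθ : θ ∈ box n k J) :
    (J : ℝ) ^ 2 * ‖η‖ ^ 2 ≤ ‖(J : ℝ) • η + natVec θ‖ ^ 2 ∧
      ‖(J : ℝ) • η + natVec θ‖ ^ 2 ≤ (J : ℝ) ^ 2 * (‖η‖ ^ 2 + n) := by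
  have hcoord : ∀ i, ((J : ℝ) • η + natVec θ) i ^ 2 = (J : ℝ) ^ 2 * η i ^ 2 + (θ i : ℝ) ^ 2 := by
    intro i
    simp only [natVec, PiLp.add_apply, PiLp.smul_apply, smul_eq_mul]
    rcases lt_or_ge (i : ℕ) k with hi | hi
    · rw [mem_box_zero hθ hi]; push_cast; ring
    · rw [hη i hi]; ring
  simp only [EuclideanSpace.real_norm_sq_eq, hcoord, Finset.sum_add_distrib, ← Finset.mul_sum]
  refine ⟨le_add_of_nonneg_right (Finset.sum_nonneg fun i _ => sq_nonneg _), ?_⟩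
  rw [mul_add]
  gcongr
  calc ∑ i, (θ i : ℝ) ^ 2 ≤ ∑ _i : Fin n, (J : ℝ) ^ 2 := by
        gcongr with i
        exact_mod_cast mem_box_le hθ i
    _ = _ := by simp [mul_comm]

/-- For `r ≥ 0` the upper frequency bound suffices. For `r < 0` the lower one is needed, and it is
nontrivial only if `η ≠ 0`. -/
theorem exists_freq_rpow_le {k : ℕ} {η : Eu n} (hη : ∀ i : Fin n, k ≤ (i : ℕ) → η i = 0)
    {r : ℝ} (hr : 0 ≤ r ∨ η ≠ 0) :
    ∃ D : ℝ, 0 ≤ D ∧ ∀ J : ℕ, 1 ≤ J → ∀ θ ∈ box n k J,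
      (1 + ‖(J : ℝ) • η + natVec θ‖ ^ 2) ^ r ≤ D * (J : ℝ) ^ (2 * r) := by
  have hpow : ∀ J : ℕ, ((J : ℝ) ^ 2) ^ r = (J : ℝ) ^ (2 * r) := fun J => by
    rw [Real.rpow_mul (Nat.cast_nonneg J), Real.rpow_two]
  rcases le_or_gt 0 r with hr0 | hr0
  · refine ⟨(1 + ‖η‖ ^ 2 + n) ^ r, by positivity, fun J hJ θ hθ => ?_⟩
    have hJ1 : (1 : ℝ) ≤ (J : ℝ) ^ 2 := one_le_pow₀ (by exact_mod_cast hJ)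
    rw [← hpow, ← Real.mul_rpow (by positivity) (by positivity)]
    refine Real.rpow_le_rpow (by positivity) ?_ hr0
    nlinarith [(freq_bounds hη hθ).2]
  · have hη0 : η ≠ 0 := hr.resolve_left (not_le.2 hr0)
    have hη1 : 0 < ‖η‖ := norm_pos_iff.2 hη0
    refine ⟨(‖η‖ ^ 2) ^ r, by positivity, fun J hJ θ hθ => ?_⟩
    have hJ0 : (0 : ℝ) < J := by exact_mod_cast hJ
    rw [← hpow, ← Real.mul_rpow (by positivity) (by positivity)]
    refine Real.rpow_le_rpow_of_nonpos (by positivity) ?_ hr0.le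
    nlinarith [(freq_bounds hη hθ).1]

/-- A mean of plane waves with frequencies of size about `J`, multiplied by `Jᵃ`. -/
def packet (k : ℕ) (a : ℝ) (η : Eu n) (J : ℕ) (x : Eu n) : ℂ :=
  (((J : ℝ) ^ a * ((J : ℝ) ^ (n - k))⁻¹ : ℝ) : ℂ) *
    ∑ θ ∈ box n k J, wave ((J : ℝ) • η + natVec θ) x

theorem contDiff_packet (k : ℕ) (a : ℝ) (η : Eu n) (J : ℕ) : ContDiff ℝ ∞ (packet k a η J) :=
  contDiff_const.mul (ContDiff.sum fun _ _ => contDiff_wave _)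

theorem fourierLoc_packet (k : ℕ) (a : ℝ) (η : Eu n) (J : ℕ) (φ : Test n) (ξ : Eu n) :
    fourierLoc (ofFun (packet k a η J)) φ ξ =
      (((J : ℝ) ^ a * ((J : ℝ) ^ (n - k))⁻¹ : ℝ) : ℂ) *
        ∑ θ ∈ box n k J, fhat φ (ξ - ((J : ℝ) • η + natVec θ)) :=
  fourierLoc_ofFun_wave_sum _ _ _ _ _

theorem measurable_fourierLoc_packet (k : ℕ) (a : ℝ) (η : Eu n) (J : ℕ) (φ : Test n) :
    Measurable (fourierLoc (ofFun (packet k a η J)) φ) := by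
  have hf := continuous_fhat φ
  refine Continuous.measurable (Continuous.congr ?_ fun ξ => (fourierLoc_packet k a η J φ ξ).symm)
  fun_prop

theorem locSeminorm_packet_lt_top (k : ℕ) (a : ℝ) (η : Eu n) (J : ℕ) (φ : Test n) (r : ℝ) :
    locSeminorm r φ Set.univ (ofFun (packet k a η J)) < ⊤ := by
  obtain ⟨C, -, hC⟩ := exists_lintegral_packet_le φ r
  refine ENNReal.rpow_lt_top_of_nonneg (by norm_num) (ne_of_lt ?_)
  simp only [fourierLoc_packet, Measure.restrict_univ]
  exact (hC _ _ _).trans_lt ENNReal.ofReal_lt_top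

theorem tendsto_rpow_natCast_atTop_zero {s : ℝ} (hs : s < 0) :
    Tendsto (fun J : ℕ => (J : ℝ) ^ s) atTop (𝓝 0) := by
  have := (tendsto_rpow_neg_atTop (neg_pos.2 hs)).comp (tendsto_natCast_atTop_atTop (R := ℝ))
  simpa [Function.comp_def] using this

theorem tendsto_locSeminorm_packet {k : ℕ} (hkn : k ≤ n) {a r : ℝ} {η : Eu n}
    (hη : ∀ i : Fin n, k ≤ (i : ℕ) → η i = 0) (hr : 0 ≤ r ∨ η ≠ 0)
    (har : a + r < ((n : ℝ) - k) / 2) (φ : Test n) :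
    Tendsto (fun J => locSeminorm r φ Set.univ (ofFun (packet k a η J))) atTop (𝓝 0) := by
  obtain ⟨C, hC0, hC⟩ := exists_lintegral_packet_le φ r
  obtain ⟨D, hD0, hD⟩ := exists_freq_rpow_le hη hr
  have hlim : Tendsto (fun J : ℕ => (ENNReal.ofReal
      (C * D * (J : ℝ) ^ (2 * a + 2 * r - (n - k : ℕ)))) ^ (1 / 2 : ℝ)) atTop (𝓝 0) := by
    -- The exponent collects `2a` and `2r` from amplitude and weight, and `-2(n-k) + (n-k)` from
    -- averaging and the number of terms.
    have h1 : 2 * a + 2 * r - ((n - k : ℕ) : ℝ) < 0 := by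
      rw [Nat.cast_sub hkn]; linarith
    have h2 := ((tendsto_rpow_natCast_atTop_zero h1).const_mul (C * D))
    have h3 := ((ENNReal.continuous_rpow_const (y := (1 / 2 : ℝ))).tendsto _).comp
      (ENNReal.tendsto_ofReal h2)
    simpa [Function.comp_def] using h3
  refine tendsto_of_tendsto_of_tendsto_of_le_of_le' tendsto_const_nhds hlim
    (Eventually.of_forall fun _ => zero_le) ?_
  filter_upwards [eventually_ge_atTop 1] with J hJ
  have hJ0 : (0 : ℝ) < J := by exact_mod_cast hJ
  refine ENNReal.rpow_le_rpow ?_ (by norm_num)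
  simp only [fourierLoc_packet, Measure.restrict_univ]
  refine (hC _ _ _).trans (ENNReal.ofReal_le_ofReal ?_)
  rw [Complex.norm_real, Real.norm_of_nonneg (by positivity)]
  have hsum : ∑ θ ∈ box n k J, (1 + ‖(J : ℝ) • η + natVec θ‖ ^ 2) ^ r ≤
      (J : ℝ) ^ (n - k) * (D * (J : ℝ) ^ (2 * r)) := by
    refine (Finset.sum_le_card_nsmul _ _ _ fun θ hθ => hD J hJ θ hθ).trans_eq ?_
    rw [card_box hkn, nsmul_eq_mul]
    push_cast
    rfl
  calc C * ((J : ℝ) ^ a * ((J : ℝ) ^ (n - k))⁻¹) ^ 2 *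
        ∑ θ ∈ box n k J, (1 + ‖(J : ℝ) • η + natVec θ‖ ^ 2) ^ r
      ≤ C * ((J : ℝ) ^ a * ((J : ℝ) ^ (n - k))⁻¹) ^ 2 *
        ((J : ℝ) ^ (n - k) * (D * (J : ℝ) ^ (2 * r))) := by gcongr
    _ = C * D * (((J : ℝ) ^ a) ^ 2 * (J : ℝ) ^ (2 * r) * ((J : ℝ) ^ (n - k))⁻¹) := by
        field_simp
    _ = _ := by
        rw [← Real.rpow_mul_natCast hJ0.le, ← Real.rpow_natCast (J : ℝ) (n - k),
          ← Real.rpow_neg hJ0.le, ← Real.rpow_add hJ0, ← Real.rpow_add hJ0]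
        push_cast
        ring_nf

/-- All frequencies have norm at least `J ‖η‖`, so rapid decay, uniform on compact sets of test
functions, beats the factor `J ^ a`. -/
theorem tendsto_ofFun_packet {k : ℕ} (hkn : k ≤ n) (a : ℝ) {η : Eu n}
    (hη : ∀ i : Fin n, k ≤ (i : ℕ) → η i = 0) (hη0 : η ≠ 0) :
    Tendsto (fun J => ofFun (packet k a η J)) atTop (𝓝 0) := by
  have hη1 : 0 < ‖η‖ := norm_pos_iff.2 hη0
  rw [(CompactConvergenceCLM.hasBasis_nhds_zero_of_basis Metric.nhds_basis_ball).tendsto_right_iff]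
  rintro ⟨S, ε⟩ ⟨hS, hε⟩
  obtain ⟨M, hM⟩ := exists_nat_gt a
  obtain ⟨C, hC0, hC⟩ := exists_norm_fhat_le
    (hS.image (TestFunction.postcompCLM (𝕜 := ℝ) (n := ⊤) (Ω := (⊤ : Opens (Eu n)))
      Complex.ofRealCLM).continuous) M
  have hlim : Tendsto (fun J : ℕ => C * ((‖η‖ ^ 2) ^ M)⁻¹ * (J : ℝ) ^ (a - 2 * M))
      atTop (𝓝 0) := by
    have h1 : a - 2 * M < 0 := by
      have : (0 : ℝ) ≤ M := Nat.cast_nonneg M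
      linarith
    simpa using (tendsto_rpow_natCast_atTop_zero h1).const_mul (C * ((‖η‖ ^ 2) ^ M)⁻¹)
  filter_upwards [eventually_ge_atTop 1, hlim.eventually_lt_const hε] with J hJ hJε ψ hψ
  have hJ0 : (0 : ℝ) < J := by exact_mod_cast hJ
  rw [mem_ball_zero_iff]
  refine lt_of_le_of_lt ?_ hJε
  have he : ofFun (packet k a η J) ψ = _ := ofFun_wave_sum_apply _ _ _ ψ
  rw [he, norm_mul, Complex.norm_real, Real.norm_of_nonneg (by positivity)]
  have hsum : ‖∑ θ ∈ box n k J, fhat (TestFunction.postcompCLM Complex.ofRealCLM ψ)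
      (-((J : ℝ) • η + natVec θ))‖ ≤
      (J : ℝ) ^ (n - k) * (C * (((J : ℝ) ^ 2 * ‖η‖ ^ 2) ^ M)⁻¹) := by
    refine (norm_sum_le _ _).trans ((Finset.sum_le_card_nsmul _ _
      (C * (((J : ℝ) ^ 2 * ‖η‖ ^ 2) ^ M)⁻¹) fun θ hθ => ?_).trans_eq ?_)
    · refine (hC _ ⟨ψ, hψ, rfl⟩ _).trans ?_
      rw [norm_neg]
      gcongr
      linarith [(freq_bounds hη hθ).1]
    · rw [card_box hkn, nsmul_eq_mul]
      push_cast
      rfl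
  calc _ ≤ (J : ℝ) ^ a * ((J : ℝ) ^ (n - k))⁻¹ *
        ((J : ℝ) ^ (n - k) * (C * (((J : ℝ) ^ 2 * ‖η‖ ^ 2) ^ M)⁻¹)) := by gcongr
    _ = C * ((‖η‖ ^ 2) ^ M)⁻¹ * ((J : ℝ) ^ a * (((J : ℝ) ^ 2) ^ M)⁻¹) := by
        rw [mul_pow]
        field_simp
    _ = _ := by
        rw [← pow_mul (J : ℝ), ← Real.rpow_natCast (J : ℝ) (2 * M), ← Real.rpow_neg hJ0.le,
          ← Real.rpow_add hJ0]
        push_cast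
        rfl

/-- The range is orthogonal to every `θ` in the box, so all the waves agree there and their number
cancels the normalization. -/
theorem packet_comp_stdMap {k : ℕ} (hkm : k ≤ m) (hkn : k ≤ n) (a : ℝ) {ξ₀ : Eu m}
    (hξ : ∀ i : Fin m, k ≤ (i : ℕ) → ξ₀ i = 0) {J : ℕ} (hJ : 1 ≤ J) :
    packet k a (stdMap n hkm ξ₀) J ∘ stdMap n hkm =
      fun x => (((J : ℝ) ^ a : ℝ) : ℂ) * wave ((J : ℝ) • ξ₀) x := by
  funext x
  have hJ0 : (J : ℂ) ≠ 0 := by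
    have : J ≠ 0 := by omega
    exact_mod_cast this
  have hin : ∀ θ ∈ box n k J, inner ℝ (stdMap n hkm x) ((J : ℝ) • stdMap n hkm ξ₀ + natVec θ) =
      inner ℝ x ((J : ℝ) • ξ₀) := by
    intro θ hθ
    obtain ⟨d, rfl⟩ := Nat.exists_eq_add_of_le hkn
    obtain ⟨e, rfl⟩ := Nat.exists_eq_add_of_le hkm
    simp only [PiLp.inner_apply, RCLike.inner_apply, conj_trivial, Fin.sum_univ_add]
    congr 1
    · refine Finset.sum_congr rfl fun i _ => ?_
      have h0 : θ (Fin.castAdd d i) = 0 := mem_box_zero hθ (by simp)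
      simp [stdMap, natVec, h0]
      rfl
    · rw [Finset.sum_eq_zero, Finset.sum_eq_zero]
      · intro i _
        simp [hξ (Fin.natAdd k i) (by simp)]
      · intro i _
        simp [stdMap]
  simp only [Function.comp, packet]
  rw [Finset.sum_congr rfl fun θ hθ => (by rw [wave, hin θ hθ] :
    wave ((J : ℝ) • stdMap n hkm ξ₀ + natVec θ) (stdMap n hkm x) =
      Complex.exp (Complex.I * (inner ℝ x ((J : ℝ) • ξ₀) : ℝ))), Finset.sum_const, card_box hkn,
    nsmul_eq_mul, wave]
  push_cast
  field_simp

/-! ### Seminorm balls and convergence to zero -/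

theorem locSeminorm_mono_set (r : ℝ) (φ : Test n) (u : Distr n) {V W : Set (Eu n)} (h : V ⊆ W) :
    locSeminorm r φ V u ≤ locSeminorm r φ W u :=
  ENNReal.rpow_le_rpow (lintegral_mono_set h) (by norm_num)

theorem locSeminorm_mono_exponent {r s : ℝ} (h : r ≤ s) (φ : Test n) (u : Distr n)
    (V : Set (Eu n)) : locSeminorm r φ V u ≤ locSeminorm s φ V u := by
  refine ENNReal.rpow_le_rpow (lintegral_mono fun ξ => ?_) (by norm_num)
  gcongr
  nlinarith [sq_nonneg ‖ξ‖]

theorem locSeminorm_zero (r : ℝ) (φ : Test n) (V : Set (Eu n)) :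
    locSeminorm r φ V (0 : Distr n) = 0 := by
  simp [locSeminorm, fourierLoc_zero]

/-- Young's inequality, weighted so that the constant in front of `b` can be taken arbitrarily close
to `1`. -/
theorem enorm_sub_sq_le {E : Type*} [NormedAddCommGroup E] (a b : E) {δ : ℝ} (hδ : 0 < δ) :
    ‖a - b‖ₑ ^ 2 ≤ ENNReal.ofReal (1 + δ⁻¹) * ‖a‖ₑ ^ 2 + ENNReal.ofReal (1 + δ) * ‖b‖ₑ ^ 2 := by
  simp only [← ofReal_norm]
  rw [← ENNReal.ofReal_pow (norm_nonneg _), ← ENNReal.ofReal_pow (norm_nonneg _),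
    ← ENNReal.ofReal_pow (norm_nonneg _), ← ENNReal.ofReal_mul (by positivity),
    ← ENNReal.ofReal_mul (by positivity), ← ENNReal.ofReal_add (by positivity) (by positivity)]
  refine ENNReal.ofReal_le_ofReal ?_
  have h1 : ‖a - b‖ ^ 2 ≤ (‖a‖ + ‖b‖) ^ 2 := by
    gcongr
    exact norm_sub_le a b
  have h2 : 2 * ‖a‖ * ‖b‖ ≤ δ⁻¹ * ‖a‖ ^ 2 + δ * ‖b‖ ^ 2 := by
    have : δ⁻¹ * ‖a‖ ^ 2 + δ * ‖b‖ ^ 2 - 2 * ‖a‖ * ‖b‖ = δ⁻¹ * (‖a‖ - δ * ‖b‖) ^ 2 := by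
      field_simp
      ring
    have h3 : 0 ≤ δ⁻¹ * (‖a‖ - δ * ‖b‖) ^ 2 := by positivity
    linarith
  nlinarith

/-- Balls of the seminorms absorb perturbations which tend to zero; only the perturbations are
required to have measurable localized Fourier transforms. -/
theorem eventually_locSeminorm_sub_lt {r : ℝ} {φ : Test n} {V : Set (Eu n)} {u : ℕ → Distr n}
    (hmeas : ∀ j, Measurable (fourierLoc (u j) φ))
    (hu : Tendsto (fun j => locSeminorm r φ V (u j)) atTop (𝓝 0)) {w : Distr n} {ε : ENNReal}
    (hw : locSeminorm r φ V (0 - w) < ε) : ∀ᶠ j in atTop, locSeminorm r φ V (u j - w) < ε := by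
  set P := ∫⁻ ξ in V, ‖fourierLoc w φ ξ‖ₑ ^ 2 * ENNReal.ofReal ((1 + ‖ξ‖ ^ 2) ^ r) with hP
  set Q := fun j => ∫⁻ ξ in V, ‖fourierLoc (u j) φ ξ‖ₑ ^ 2 * ENNReal.ofReal ((1 + ‖ξ‖ ^ 2) ^ r)
    with hQ
  have hlt : ∀ x : ENNReal, x ^ (1 / 2 : ℝ) < ε ↔ x < ε ^ (2 : ℝ) := fun x => by
    rw [← ENNReal.rpow_lt_rpow_iff (z := 2) two_pos, ← ENNReal.rpow_mul]
    norm_num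
  have hPε : P < ε ^ (2 : ℝ) := by
    rw [← hlt]
    simp only [locSeminorm, fourierLoc_sub, fourierLoc_zero] at hw
    simpa only [zero_sub, enorm_neg] using hw
  have hQ0 : Tendsto Q atTop (𝓝 0) := by
    have h := ((ENNReal.continuous_rpow_const (y := (2 : ℝ))).tendsto _).comp hu
    have he : ∀ j, (locSeminorm r φ V (u j)) ^ (2 : ℝ) = Q j := fun j => by
      rw [locSeminorm, ← ENNReal.rpow_mul]
      norm_num [hQ]
    rw [ENNReal.zero_rpow_of_pos two_pos] at h
    exact h.congr he
  -- The strict inequality for `w` leaves room for a factor slightly larger than `1`; the large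
  -- factor `1 + δ⁻¹` falls on `Q j`, which tends to zero.
  obtain ⟨δ, hδ, hδP⟩ : ∃ δ : ℝ, 0 < δ ∧ ENNReal.ofReal (1 + δ) * P < ε ^ (2 : ℝ) := by
    have h1 : Tendsto (fun δ : ℝ => ENNReal.ofReal (1 + δ) * P) (𝓝[>] 0)
        (𝓝 (ENNReal.ofReal (1 + 0) * P)) := by
      refine ENNReal.Tendsto.mul_const ?_ (Or.inr hPε.ne_top)
      refine ENNReal.tendsto_ofReal (Tendsto.mono_left ?_ nhdsWithin_le_nhds)
      exact (continuous_const.add continuous_id).tendsto 0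
    have h2 := h1.eventually_lt_const (u := ε ^ (2 : ℝ)) (by simpa using hPε)
    obtain ⟨δ, h3, h4⟩ := (h2.and self_mem_nhdsWithin).exists
    exact ⟨δ, h4, h3⟩
  have hbound : ∀ j, ∫⁻ ξ in V, ‖fourierLoc (u j - w) φ ξ‖ₑ ^ 2 *
      ENNReal.ofReal ((1 + ‖ξ‖ ^ 2) ^ r) ≤
      ENNReal.ofReal (1 + δ⁻¹) * Q j + ENNReal.ofReal (1 + δ) * P := by
    intro j
    have hm : Measurable fun ξ => ENNReal.ofReal (1 + δ⁻¹) *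
        (‖fourierLoc (u j) φ ξ‖ₑ ^ 2 * ENNReal.ofReal ((1 + ‖ξ‖ ^ 2) ^ r)) := by
      have := (hmeas j).enorm
      fun_prop
    calc _ ≤ ∫⁻ ξ in V, (ENNReal.ofReal (1 + δ⁻¹) *
          (‖fourierLoc (u j) φ ξ‖ₑ ^ 2 * ENNReal.ofReal ((1 + ‖ξ‖ ^ 2) ^ r)) +
          ENNReal.ofReal (1 + δ) *
          (‖fourierLoc w φ ξ‖ₑ ^ 2 * ENNReal.ofReal ((1 + ‖ξ‖ ^ 2) ^ r))) := by
          refine lintegral_mono fun ξ => ?_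
          rw [fourierLoc_sub, ← mul_assoc, ← mul_assoc, ← add_mul]
          gcongr
          exact enorm_sub_sq_le _ _ hδ
      _ = _ := by
          rw [lintegral_add_left hm, lintegral_const_mul' _ _ ENNReal.ofReal_ne_top,
            lintegral_const_mul' _ _ ENNReal.ofReal_ne_top]
  have hlim : Tendsto (fun j => ENNReal.ofReal (1 + δ⁻¹) * Q j + ENNReal.ofReal (1 + δ) * P) atTop
      (𝓝 (ENNReal.ofReal (1 + δ) * P)) := by
    have h := (ENNReal.Tendsto.const_mul hQ0 (a := ENNReal.ofReal (1 + δ⁻¹))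
      (Or.inr ENNReal.ofReal_ne_top)).add_const (ENNReal.ofReal (1 + δ) * P)
    simpa using h
  filter_upwards [hlim.eventually_lt_const hδP] with j hj
  rw [locSeminorm, hlt]
  exact (hbound j).trans_lt hj

/-- The topology is generated by balls with arbitrary centres, so every ball that contains zero has
to be considered, not only those centred there. -/
theorem HLoc.tendsto_zero {r : ℝ} {x : ℕ → HLoc n r} {z : HLoc n r} (hz : z.toDistr = 0)
    (hmeas : ∀ j φ, Measurable (fourierLoc (x j).toDistr φ))
    (hx : ∀ φ, Tendsto (fun j => locSeminorm r φ Set.univ (x j).toDistr) atTop (𝓝 0)) :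
    Tendsto x atTop (𝓝 z) := by
  refine tendsto_nhds_generateFrom_iff.2 ?_
  rintro s ⟨φ, w, ε, -, rfl⟩ hzs
  rw [Set.mem_ofPred_eq, hz] at hzs
  exact eventually_locSeminorm_sub_lt (fun j => hmeas j φ) (hx φ) hzs

/-- The balls of the seminorms which define the topology of `DSob n r L`. -/
def DSob.balls (n : ℕ) (r : ℝ) (L : Set (Eu n × Eu n)) : Set (Set (DSob n r L)) :=
  {s | ∃ (φ : Test n) (V : Set (Eu n)) (u : DSob n r L) (ε : ENNReal),
    IsClosed V ∧ IsCone V ∧ (tsupport φ ×ˢ V) ∩ L = ∅ ∧ 0 < ε ∧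
    s = {v | locSeminorm r φ V (v.toDistr - u.toDistr) < ε}}

theorem DSob.nhds_eq {r : ℝ} {L : Set (Eu n × Eu n)} (z : DSob n r L) :
    𝓝 z = comap DSob.toDistr (𝓝 z.toDistr) ⊓ @nhds _ (generateFrom (DSob.balls n r L)) z := by
  rw [← nhds_induced]
  exact nhds_inf (t₁ := TopologicalSpace.induced DSob.toDistr inferInstance)
    (t₂ := generateFrom (DSob.balls n r L))

theorem DSob.ball_mem_nhds {r : ℝ} {L : Set (Eu n × Eu n)} (z : DSob n r L) {φ : Test n}
    {V : Set (Eu n)} (hV : IsClosed V) (hc : IsCone V) (hL : (tsupport φ ×ˢ V) ∩ L = ∅)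
    {ε : ENNReal} (hε : 0 < ε) :
    {v : DSob n r L | locSeminorm r φ V (v.toDistr - z.toDistr) < ε} ∈ 𝓝 z := by
  rw [DSob.nhds_eq]
  refine mem_inf_of_right ?_
  let _ := generateFrom (DSob.balls n r L)
  refine IsOpen.mem_nhds (isOpen_generateFrom_of_mem ⟨φ, V, z, ε, hV, hc, hL, hε, rfl⟩) ?_
  rw [Set.mem_ofPred_eq, sub_self, locSeminorm_zero]
  exact hε

theorem DSob.tendsto_zero {r : ℝ} {L : Set (Eu n × Eu n)} {x : ℕ → DSob n r L} {z : DSob n r L}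
    (hz : z.toDistr = 0) (hmeas : ∀ j φ, Measurable (fourierLoc (x j).toDistr φ))
    (hD : Tendsto (fun j => (x j).toDistr) atTop (𝓝 0))
    (hx : ∀ φ, Tendsto (fun j => locSeminorm r φ Set.univ (x j).toDistr) atTop (𝓝 0)) :
    Tendsto x atTop (𝓝 z) := by
  rw [DSob.nhds_eq, tendsto_inf]
  constructor
  · rw [tendsto_comap_iff, hz]
    exact hD
  · refine tendsto_nhds_generateFrom_iff.2 ?_
    rintro s ⟨φ, V, w, ε, -, -, -, -, rfl⟩ hzs
    rw [Set.mem_ofPred_eq, hz] at hzs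
    refine eventually_locSeminorm_sub_lt (fun j => hmeas j φ) ?_ hzs
    exact tendsto_of_tendsto_of_tendsto_of_le_of_le tendsto_const_nhds (hx φ)
      (fun _ => zero_le) fun j => locSeminorm_mono_set r φ _ (Set.subset_univ V)

/-! ### Bump functions and the lower bound for one wave -/

/-- A complex test function supported in the closed ball of radius `R` with positive integral. -/
def bumpTest (c : Eu n) (R : ℝ) (hR : 0 < R) : Test n :=
  let b : ContDiffBump c := ⟨R / 2, R, by linarith, by linarith⟩
  { toFun := fun x => (b x : ℂ)
    contDiff' := Complex.ofRealCLM.contDiff.comp b.contDiff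
    hasCompactSupport' := b.hasCompactSupport.comp_left Complex.ofReal_zero
    tsupport_subset' := fun _ _ => trivial }

theorem bumpTest_self (c : Eu n) {R : ℝ} (hR : 0 < R) : bumpTest c R hR c ≠ 0 := by
  let b : ContDiffBump c := ⟨R / 2, R, by linarith, by linarith⟩
  change ((b c : ℝ) : ℂ) ≠ 0
  rw [b.one_of_mem_closedBall (Metric.mem_closedBall_self b.rIn_pos.le)]
  simp

theorem tsupport_bumpTest_subset (c : Eu n) {R : ℝ} (hR : 0 < R) :
    tsupport (bumpTest c R hR) ⊆ Metric.closedBall c R := by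
  let b : ContDiffBump c := ⟨R / 2, R, by linarith, by linarith⟩
  rw [← b.tsupport_eq]
  refine closure_mono fun x hx hb => hx ?_
  change ((b x : ℝ) : ℂ) = 0
  rw [hb, Complex.ofReal_zero]

theorem integral_bumpTest_ne_zero (c : Eu n) {R : ℝ} (hR : 0 < R) :
    ∫ x, bumpTest c R hR x ≠ 0 := by
  let b : ContDiffBump c := ⟨R / 2, R, by linarith, by linarith⟩
  change ∫ x, ((b x : ℝ) : ℂ) ≠ 0
  rw [integral_complex_ofReal]
  exact_mod_cast (b.integral_pos (μ := volume)).ne'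

theorem WFSob_eq_empty {r : ℝ} {u : Distr n} (h : ∀ φ, locSeminorm r φ Set.univ u < ⊤) :
    WFSob r u = ∅ := by
  refine Set.eq_empty_iff_forall_notMem.2 fun p hp => hp.2 ?_
  exact ⟨Set.univ, bumpTest p.1 1 one_pos, isOpen_univ, fun _ _ _ _ => trivial, trivial,
    bumpTest_self _ _, h _⟩

theorem fourierLoc_ofFun_wave (κ : Eu n) (c : ℂ) (φ : Test n) (ξ : Eu n) :
    fourierLoc (ofFun fun x => c * wave κ x) φ ξ = c * fhat φ (ξ - κ) := by
  simpa using fourierLoc_ofFun_wave_sum {()} (fun _ => κ) c φ ξ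

/-- Near `J ξ₀` the localized transform is `J ^ (-r)` times values of `fhat φ` near `0`, and the
weight is comparable to `J ^ (2r)`. The integral over a ball of fixed radius is thus bounded below.
-/
theorem exists_le_locSeminorm_wave {r : ℝ} {φ : Test n} (hφ : fhat φ 0 ≠ 0) {ξ₀ : Eu n}
    (hξ : ξ₀ ≠ 0) {V : Set (Eu n)} {δ : ℝ} (hδ : 0 < δ)
    (hV : ∀ J : ℕ, 1 ≤ J → Metric.ball ((J : ℝ) • ξ₀) δ ⊆ V) :
    ∃ c : ENNReal, 0 < c ∧ ∀ J : ℕ, 1 ≤ J →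
      c ≤ locSeminorm r φ V (ofFun fun x => (((J : ℝ) ^ (-r) : ℝ) : ℂ) * wave ((J : ℝ) • ξ₀) x) := by
  have hξ0 : 0 < ‖ξ₀‖ := norm_pos_iff.2 hξ
  have hb : 0 < ‖fhat φ 0‖ := norm_pos_iff.2 hφ
  obtain ⟨ρ, hρ0, hρ⟩ : ∃ ρ > 0, ∀ ζ : Eu n, ‖ζ‖ < ρ → ‖fhat φ 0‖ / 2 < ‖fhat φ ζ‖ := by
    have h := ((continuous_fhat φ).norm.tendsto 0).eventually_const_lt (half_lt_self hb)
    obtain ⟨ρ, hρ0, hρ⟩ := Metric.eventually_nhds_iff.1 h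
    exact ⟨ρ, hρ0, fun ζ hζ => hρ (by simpa using hζ)⟩
  obtain ⟨D, hD0, hD⟩ : ∃ D > 0, ∀ J : ℕ, 1 ≤ J →
      D * (J : ℝ) ^ (2 * r) ≤ (1 + ‖(J : ℝ) • ξ₀‖ ^ 2) ^ r := by
    have hpow : ∀ J : ℕ, ((J : ℝ) ^ 2) ^ r = (J : ℝ) ^ (2 * r) := fun J => by
      rw [Real.rpow_mul (Nat.cast_nonneg J), Real.rpow_two]
    rcases le_total 0 r with hr | hr
    · refine ⟨(‖ξ₀‖ ^ 2) ^ r, by positivity, fun J hJ => ?_⟩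
      rw [← hpow, ← Real.mul_rpow (by positivity) (by positivity)]
      refine Real.rpow_le_rpow (by positivity) ?_ hr
      rw [norm_smul, mul_pow, Real.norm_natCast]
      linarith
    · refine ⟨(1 + ‖ξ₀‖ ^ 2) ^ r, by positivity, fun J hJ => ?_⟩
      have hJ1 : (1 : ℝ) ≤ (J : ℝ) ^ 2 := one_le_pow₀ (by exact_mod_cast hJ)
      rw [← hpow, ← Real.mul_rpow (by positivity) (by positivity)]
      refine Real.rpow_le_rpow_of_nonpos (by positivity) ?_ hr
      rw [norm_smul, mul_pow, Real.norm_natCast]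
      linarith
  -- Radius `δ` keeps the ball in `V`, `ρ` keeps `fhat φ` above half its value at `0`, and `1`
  -- bounds the Peetre factor by `2 ^ |r|`.
  set σ := min δ (min ρ 1) with hσ
  have hσ0 : 0 < σ := by positivity
  set A : ℝ := (‖fhat φ 0‖ / 2) ^ 2 * (D * ((2 : ℝ) ^ |r| * 2 ^ |r|)⁻¹) with hA
  have hA0 : 0 < A := by positivity
  have hvol : volume (Metric.ball (0 : Eu n) σ) ≠ 0 := (Metric.measure_ball_pos _ _ hσ0).ne'
  refine ⟨(ENNReal.ofReal A * volume (Metric.ball (0 : Eu n) σ)) ^ (1 / 2 : ℝ), ?_, fun J hJ => ?_⟩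
  · refine ENNReal.rpow_pos_of_nonneg (ENNReal.mul_pos (by simpa using hA0) hvol) (by norm_num)
  have hJ0 : (0 : ℝ) < J := by exact_mod_cast hJ
  refine ENNReal.rpow_le_rpow ?_ (by norm_num)
  have hpt : ∀ ξ ∈ Metric.ball ((J : ℝ) • ξ₀) σ, ENNReal.ofReal A ≤
      ‖fourierLoc (ofFun fun x => (((J : ℝ) ^ (-r) : ℝ) : ℂ) * wave ((J : ℝ) • ξ₀) x) φ ξ‖ₑ ^ 2 *
        ENNReal.ofReal ((1 + ‖ξ‖ ^ 2) ^ r) := by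
    intro ξ hξb
    rw [mem_ball_iff_norm] at hξb
    have h1 : ‖ξ - (J : ℝ) • ξ₀‖ < ρ := hξb.trans_le ((min_le_right _ _).trans (min_le_left _ _))
    have h2 : ‖ξ - (J : ℝ) • ξ₀‖ < 1 := hξb.trans_le ((min_le_right _ _).trans (min_le_right _ _))
    rw [fourierLoc_ofFun_wave, ← ofReal_norm, ← ENNReal.ofReal_pow (norm_nonneg _),
      ← ENNReal.ofReal_mul (by positivity)]
    refine ENNReal.ofReal_le_ofReal ?_
    rw [norm_mul, Complex.norm_real, Real.norm_of_nonneg (by positivity)]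
    have h3 : D * ((2 : ℝ) ^ |r| * 2 ^ |r|)⁻¹ * (J : ℝ) ^ (2 * r) ≤ (1 + ‖ξ‖ ^ 2) ^ r := by
      have hp := peetre r ((J : ℝ) • ξ₀) ξ
      have hq : (1 + ‖(J : ℝ) • ξ₀ - ξ‖ ^ 2) ^ |r| ≤ (2 : ℝ) ^ |r| := by
        refine Real.rpow_le_rpow (by positivity) ?_ (abs_nonneg r)
        rw [norm_sub_rev]
        nlinarith [norm_nonneg (ξ - (J : ℝ) • ξ₀)]
      have h4 : D * (J : ℝ) ^ (2 * r) ≤ (2 : ℝ) ^ |r| * 2 ^ |r| * (1 + ‖ξ‖ ^ 2) ^ r :=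
        (hD J hJ).trans (hp.trans (by gcongr))
      rw [mul_right_comm, ← div_eq_mul_inv, div_le_iff₀ (by positivity)]
      linarith
    have h5 : ((J : ℝ) ^ (-r)) ^ 2 * (J : ℝ) ^ (2 * r) = 1 := by
      rw [← Real.rpow_mul_natCast hJ0.le, ← Real.rpow_add hJ0]
      push_cast
      rw [show -r * 2 + 2 * r = 0 by ring, Real.rpow_zero]
    calc A = A * (((J : ℝ) ^ (-r)) ^ 2 * (J : ℝ) ^ (2 * r)) := by rw [h5, mul_one]
      _ = ((J : ℝ) ^ (-r) * (‖fhat φ 0‖ / 2)) ^ 2 *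
          (D * ((2 : ℝ) ^ |r| * 2 ^ |r|)⁻¹ * (J : ℝ) ^ (2 * r)) := by rw [hA]; ring
      _ ≤ _ := by
          gcongr
          exact (hρ _ h1).le
  calc ENNReal.ofReal A * volume (Metric.ball (0 : Eu n) σ)
      = ∫⁻ _ξ in Metric.ball ((J : ℝ) • ξ₀) σ, ENNReal.ofReal A := by
        rw [setLIntegral_const, Measure.addHaar_ball_center volume ((J : ℝ) • ξ₀)]
    _ ≤ _ := setLIntegral_mono' Metric.isOpen_ball.measurableSet hpt
    _ ≤ _ := lintegral_mono_set ((Metric.ball_subset_ball (min_le_left _ _)).trans (hV J hJ))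

/-! ### Closed conic sets -/

theorem IsClosedConic.mem_of_tendsto {L : Set (Eu n × Eu n)} (hL : IsClosedConic L)
    {p : ℕ → Eu n × Eu n} {q : Eu n × Eu n} (hp : ∀ j, p j ∈ L) (hpq : Tendsto p atTop (𝓝 q))
    (hq : q.2 ≠ 0) : q ∈ L := by
  have h : Tendsto (fun j => (⟨p j, hL.snd_ne_zero _ (hp j)⟩ : {p : Eu n × Eu n // p.2 ≠ 0}))
      atTop (𝓝 ⟨q, hq⟩) := tendsto_subtype_rng.2 hpq
  exact hL.closed.mem_of_tendsto h (Eventually.of_forall hp)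

theorem IsClosedConic.exists_cone {L : Set (Eu n × Eu n)} (hL : IsClosedConic L) {ξ₀ : Eu n}
    (hξ : ξ₀ ≠ 0) (h0 : ((0 : Eu n), ξ₀) ∉ L) :
    ∃ (φ : Test n) (V : Set (Eu n)) (δ : ℝ), IsClosed V ∧ IsCone V ∧ (tsupport φ ×ˢ V) ∩ L = ∅ ∧
      fhat φ 0 ≠ 0 ∧ 0 < δ ∧ ∀ J : ℕ, 1 ≤ J → Metric.ball ((J : ℝ) • ξ₀) δ ⊆ V := by
  have hξ0 : 0 < ‖ξ₀‖ := norm_pos_iff.2 hξ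
  obtain ⟨ε, hε0, hε⟩ : ∃ ε > 0, ∀ x ξ : Eu n, ‖x‖ < ε → ‖ξ - ξ₀‖ < ε → ξ ≠ 0 → (x, ξ) ∉ L := by
    have h := hL.closed.isOpen_compl.mem_nhds
      (show (⟨((0 : Eu n), ξ₀), hξ⟩ : {p : Eu n × Eu n // p.2 ≠ 0}) ∈ _ from h0)
    obtain ⟨ε, hε0, hε⟩ := Metric.mem_nhds_iff.1 h
    refine ⟨ε, hε0, fun x ξ hx hx' hn => ?_⟩
    refine hε (a := ⟨(x, ξ), hn⟩) ?_
    rw [Metric.mem_ball, Subtype.dist_eq, Prod.dist_eq, dist_zero_right, dist_eq_norm]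
    exact max_lt hx hx'
  -- The inequality says that `ξ`, rescaled to norm `‖ξ₀‖`, is within `ε / 2` of `ξ₀`. Cleared of
  -- denominators, it admits `ξ = 0` and is a closed condition; `L` has no zero covectors.
  set V : Set (Eu n) := {ξ | ‖‖ξ‖ • ξ₀ - ‖ξ₀‖ • ξ‖ ≤ ε / 2 * ‖ξ‖} with hV
  -- For `ξ = J ξ₀ + h` the defect is at most `2 ‖h‖ ‖ξ₀‖`; `‖h‖ < ε / 8` and `‖ξ‖ ≥ ‖ξ₀‖ / 2` then
  -- give `ξ ∈ V`.
  refine ⟨bumpTest 0 (ε / 2) (half_pos hε0), V, min (ε / 8) (‖ξ₀‖ / 2), ?_, ?_, ?_, ?_, ?_, ?_⟩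
  · exact isClosed_le (by fun_prop) (by fun_prop)
  · intro t ht ξ hξV
    have h1 : ‖t • ξ‖ • ξ₀ - ‖ξ₀‖ • t • ξ = t • (‖ξ‖ • ξ₀ - ‖ξ₀‖ • ξ) := by
      rw [norm_smul, Real.norm_of_nonneg ht.le, smul_sub, mul_smul, smul_comm t ‖ξ₀‖]
    change ‖‖t • ξ‖ • ξ₀ - ‖ξ₀‖ • t • ξ‖ ≤ ε / 2 * ‖t • ξ‖
    rw [h1, norm_smul, norm_smul, Real.norm_of_nonneg ht.le, mul_left_comm]
    exact mul_le_mul_of_nonneg_left hξV ht.le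
  · refine Set.eq_empty_iff_forall_notMem.2 ?_
    rintro ⟨x, ξ⟩ ⟨⟨hx, hξV⟩, hmem⟩
    have hn : ξ ≠ 0 := hL.snd_ne_zero _ hmem
    have hn0 : 0 < ‖ξ‖ := norm_pos_iff.2 hn
    have hx' : ‖x‖ < ε := by
      have := tsupport_bumpTest_subset _ _ hx
      rw [mem_closedBall_zero_iff] at this
      linarith
    refine hε x ((‖ξ₀‖ / ‖ξ‖) • ξ) hx' ?_ (smul_ne_zero (by positivity) hn)
      (hL.conic _ (by positivity) _ _ hmem)
    have h1 : (‖ξ₀‖ / ‖ξ‖) • ξ - ξ₀ = -(‖ξ‖⁻¹ • (‖ξ‖ • ξ₀ - ‖ξ₀‖ • ξ)) := by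
      rw [smul_sub, smul_smul, smul_smul, inv_mul_cancel₀ hn0.ne', one_smul, div_eq_inv_mul]
      abel
    rw [h1, norm_neg, norm_smul, norm_inv, norm_norm, inv_mul_eq_div, div_lt_iff₀ hn0]
    have h2 : ‖‖ξ‖ • ξ₀ - ‖ξ₀‖ • ξ‖ ≤ ε / 2 * ‖ξ‖ := hξV
    nlinarith
  · have := integral_bumpTest_ne_zero (0 : Eu n) (half_pos hε0)
    simpa [fhat] using this
  · positivity
  · intro J hJ ξ hξb
    have hJ1 : (1 : ℝ) ≤ J := by exact_mod_cast hJ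
    rw [mem_ball_iff_norm] at hξb
    set h := ξ - (J : ℝ) • ξ₀ with hh
    have h1 : ‖h‖ < ε / 8 := hξb.trans_le (min_le_left _ _)
    have h2 : ‖h‖ < ‖ξ₀‖ / 2 := hξb.trans_le (min_le_right _ _)
    have h3 : |‖ξ‖ - J * ‖ξ₀‖| ≤ ‖h‖ := by
      have := abs_norm_sub_norm_le ξ ((J : ℝ) • ξ₀)
      rwa [norm_smul, Real.norm_natCast] at this
    have h4 : ‖ξ‖ • ξ₀ - ‖ξ₀‖ • ξ = (‖ξ‖ - J * ‖ξ₀‖) • ξ₀ - ‖ξ₀‖ • h := by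
      rw [hh, smul_sub, sub_smul, smul_smul, mul_comm ‖ξ₀‖]
      abel
    change ‖‖ξ‖ • ξ₀ - ‖ξ₀‖ • ξ‖ ≤ ε / 2 * ‖ξ‖
    have h5 : ‖‖ξ‖ • ξ₀ - ‖ξ₀‖ • ξ‖ ≤ ‖h‖ * ‖ξ₀‖ + ‖ξ₀‖ * ‖h‖ := by
      rw [h4]
      refine (norm_sub_le _ _).trans ?_
      rw [norm_smul, norm_smul, norm_norm, Real.norm_eq_abs]
      gcongr
    have h6 : ‖ξ₀‖ / 2 ≤ ‖ξ‖ := by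
      have := (abs_le.1 h3).1
      nlinarith
    nlinarith

/-! ### The transpose and the pulled-back conic set -/

/-- `stdMap` as a continuous linear map. -/
def stdMapCLM (n : ℕ) {m k : ℕ} (hkm : k ≤ m) : Eu m →L[ℝ] Eu n :=
  LinearMap.toContinuousLinearMap
    { toFun := stdMap n hkm
      map_add' := fun x y => by
        ext i
        simp only [stdMap, PiLp.add_apply]
        split_ifs <;> simp
      map_smul' := fun c x => by
        ext i
        simp only [stdMap, PiLp.smul_apply, RingHom.id_apply, smul_eq_mul]
        split_ifs <;> simp }

theorem coe_stdMapCLM (n : ℕ) {m k : ℕ} (hkm : k ≤ m) : ⇑(stdMapCLM n hkm) = stdMap n hkm := rfl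

theorem inner_stdMap {k : ℕ} (hkm : k ≤ m) (hkn : k ≤ n) (x : Eu m) (η : Eu n) :
    inner ℝ (stdMap n hkm x) η = inner ℝ x (stdMap m hkn η) := by
  obtain ⟨d, rfl⟩ := Nat.exists_eq_add_of_le hkn
  obtain ⟨e, rfl⟩ := Nat.exists_eq_add_of_le hkm
  simp only [PiLp.inner_apply, RCLike.inner_apply, conj_trivial, Fin.sum_univ_add]
  congr 1
  · refine Finset.sum_congr rfl fun i _ => ?_
    simp [stdMap]
    rfl
  · rw [Finset.sum_eq_zero, Finset.sum_eq_zero] <;> intro i _ <;> simp [stdMap]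

theorem adjoint_fderiv_stdMap {k : ℕ} (hkm : k ≤ m) (hkn : k ≤ n) (x : Eu m) :
    ContinuousLinearMap.adjoint (fderiv ℝ (stdMap n hkm) x) = stdMapCLM m hkn := by
  rw [← coe_stdMapCLM, ContinuousLinearMap.fderiv]
  refine ((ContinuousLinearMap.eq_adjoint_iff _ _).2 fun η y => ?_).symm
  rw [coe_stdMapCLM, coe_stdMapCLM, real_inner_comm, real_inner_comm (stdMap n hkm y),
    inner_stdMap hkm hkn]

/-- Since `L` avoids the normals, the transpose kills no covector of `L` over the range. Covectors
normalized to the unit sphere subconverge, and the transpose of the limit is nonzero, so limits in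
the pulled-back set lift to `L`. -/
theorem isClosedConic_pullbackSet {k : ℕ} (hkm : k ≤ m) (hkn : k ≤ n) {L : Set (Eu n × Eu n)}
    (hL : IsClosedConic L) (hN : L ∩ normals (stdMap n hkm) = ∅) :
    IsClosedConic (pullbackSet (stdMap n hkm) L) := by
  have hker : ∀ x η, (stdMap n hkm x, η) ∈ L → stdMapCLM m hkn η ≠ 0 := fun x η hη h0 => by
    refine Set.eq_empty_iff_forall_notMem.1 hN (stdMap n hkm x, η) ⟨hη, x, rfl, ?_⟩
    rw [adjoint_fderiv_stdMap hkm hkn]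
    exact h0
  refine ⟨?_, ?_, ?_⟩
  · rintro ⟨x, ξ⟩ ⟨η, hη, hξ⟩
    rw [hξ, adjoint_fderiv_stdMap hkm hkn]
    exact hker x η hη
  · rintro t ht x ξ ⟨η, hη, hξ⟩
    exact ⟨t • η, hL.conic t ht _ _ hη, by rw [map_smul]; exact congrArg (t • ·) hξ⟩
  · refine IsSeqClosed.isClosed fun p q hp hpq => ?_
    choose η hη hpη using hp
    simp only [adjoint_fderiv_stdMap hkm hkn] at hpη
    have hη0 : ∀ j, 0 < ‖η j‖ := fun j => norm_pos_iff.2 (hL.snd_ne_zero _ (hη j))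
    have hpq' : Tendsto (fun j => (p j : Eu m × Eu m)) atTop (𝓝 q) :=
      tendsto_subtype_rng.1 hpq
    have hx := (continuous_fst.tendsto _).comp hpq'
    have hξ := (continuous_snd.tendsto _).comp hpq'
    obtain ⟨κ, hκ, s, hs, hκs⟩ := (isCompact_sphere (0 : Eu n) 1).tendsto_subseq
      (x := fun j => ‖η j‖⁻¹ • η j) fun j => by
        rw [mem_sphere_zero_iff_norm, norm_smul, norm_inv, norm_norm, inv_mul_cancel₀ (hη0 j).ne']
    have hκ0 : κ ≠ 0 := by
      rintro rfl
      simp at hκ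
    have hmem : (stdMap n hkm (q : Eu m × Eu m).1, κ) ∈ L := by
      refine hL.mem_of_tendsto
        (p := fun j => (stdMap n hkm (p (s j) : Eu m × Eu m).1, ‖η (s j)‖⁻¹ • η (s j)))
        (fun j => hL.conic _ (inv_pos.2 (hη0 _)) _ _ (hη _)) ?_ hκ0
      exact (((stdMapCLM n hkm).continuous.tendsto _).comp
        (hx.comp hs.tendsto_atTop)).prodMk_nhds hκs
    have hBκ : 0 < ‖stdMapCLM m hkn κ‖ := norm_pos_iff.2 (hker _ _ hmem)
    have hB : Tendsto (fun j => stdMapCLM m hkn (‖η (s j)‖⁻¹ • η (s j))) atTop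
        (𝓝 (stdMapCLM m hkn κ)) := ((stdMapCLM m hkn).continuous.tendsto _).comp hκs
    have hξs : Tendsto (fun j => (p (s j) : Eu m × Eu m).2) atTop (𝓝 (q : Eu m × Eu m).2) :=
      hξ.comp hs.tendsto_atTop
    -- This form of "positively proportional" is continuous in both vectors, so it passes to the
    -- limit.
    have heq : ∀ j, ‖stdMapCLM m hkn (‖η (s j)‖⁻¹ • η (s j))‖ • (p (s j) : Eu m × Eu m).2 =
        ‖(p (s j) : Eu m × Eu m).2‖ • stdMapCLM m hkn (‖η (s j)‖⁻¹ • η (s j)) := fun j => by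
      rw [hpη, map_smul, norm_smul, norm_inv, norm_norm, smul_smul, mul_comm]
    have hlim := tendsto_nhds_unique ((hB.norm.smul hξs).congr heq) (hξs.norm.smul hB)
    refine ⟨(‖(q : Eu m × Eu m).2‖ / ‖stdMapCLM m hkn κ‖) • κ, hL.conic _
      (div_pos (norm_pos_iff.2 q.2) hBκ) _ _ hmem, ?_⟩
    rw [adjoint_fderiv_stdMap hkm hkn, map_smul, div_eq_inv_mul, ← smul_smul, ← hlim, smul_smul,
      inv_mul_cancel₀ hBκ.ne', one_smul]

theorem stdMap_apply_of_le {k : ℕ} (hkm : k ≤ m) (x : Eu m) {i : Fin n} (hi : k ≤ (i : ℕ)) :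
    stdMap n hkm x i = 0 := by
  simp [stdMap, not_lt.2 hi]

theorem stdMap_castLE {k : ℕ} (hkm : k ≤ m) (hkn : k ≤ n) (x : Eu m) (i : Fin k) :
    stdMap n hkm x (Fin.castLE hkn i) = x (Fin.castLE hkm i) := by
  simp [stdMap]
  rfl

theorem stdMap_ne_zero {k : ℕ} (hkm : k ≤ m) (hkn : k ≤ n) {ξ : Eu m}
    (hξ : ∀ i : Fin m, k ≤ (i : ℕ) → ξ i = 0) (hξ0 : ξ ≠ 0) : stdMap n hkm ξ ≠ 0 := by
  intro h
  refine hξ0 (PiLp.ext fun i => ?_)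
  rcases lt_or_ge (i : ℕ) k with hi | hi
  · have := stdMap_castLE hkm hkn ξ ⟨i, hi⟩
    rw [h] at this
    exact this.symm
  · exact hξ i hi

/-! ### Failure of continuous extension -/

/-- The packet as an element of `H^r_loc`. -/
def packetHLoc (k : ℕ) (a r : ℝ) (η : Eu n) (J : ℕ) : HLoc n r :=
  ⟨ofFun (packet k a η J), fun φ => locSeminorm_packet_lt_top k a η J φ r⟩

/-- The packet as an element of `𝒟'^r_L`. -/
def packetDSob (k : ℕ) (a r : ℝ) (L : Set (Eu n × Eu n)) (η : Eu n) (J : ℕ) : DSob n r L :=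
  ⟨ofFun (packet k a η J), by
    rw [WFSob_eq_empty fun φ => locSeminorm_packet_lt_top k a η J φ r]
    exact Set.empty_subset L⟩

instance (r : ℝ) : Zero (HLoc n r) := ⟨⟨0, fun φ => by simp [locSeminorm_zero]⟩⟩

instance (r : ℝ) (L : Set (Eu n × Eu n)) : Zero (DSob n r L) :=
  ⟨⟨0, by
    rw [WFSob_eq_empty fun φ => by simp [locSeminorm_zero]]
    exact Set.empty_subset L⟩⟩

theorem tendsto_packetHLoc {k : ℕ} (hkn : k ≤ n) {a r : ℝ} {η : Eu n}
    (hη : ∀ i : Fin n, k ≤ (i : ℕ) → η i = 0) (hr : 0 ≤ r ∨ η ≠ 0)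
    (har : a + r < ((n : ℝ) - k) / 2) : Tendsto (packetHLoc k a r η) atTop (𝓝 0) :=
  HLoc.tendsto_zero rfl (fun j φ => measurable_fourierLoc_packet k a η j φ)
    fun φ => tendsto_locSeminorm_packet hkn hη hr har φ

theorem tendsto_packetDSob {k : ℕ} (hkn : k ≤ n) {a r : ℝ} (L : Set (Eu n × Eu n)) {η : Eu n}
    (hη : ∀ i : Fin n, k ≤ (i : ℕ) → η i = 0) (hη0 : η ≠ 0)
    (har : a + r < ((n : ℝ) - k) / 2) : Tendsto (packetDSob k a r L η) atTop (𝓝 0) :=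
  DSob.tendsto_zero rfl (fun j φ => measurable_fourierLoc_packet k a η j φ)
    (tendsto_ofFun_packet hkn a hη hη0)
    fun φ => tendsto_locSeminorm_packet hkn hη (Or.inr hη0) har φ

theorem ofFun_ne_zero_of_const_one : ofFun (fun _ : Eu n => (1 : ℂ)) ≠ 0 := by
  intro h
  have h1 := pairing_ofFun (continuous_const (y := (1 : ℂ))) (bumpTest (0 : Eu n) 1 one_pos)
  have h0 : ∀ ψ, (0 : Distr n) ψ = 0 := fun _ => rfl
  rw [h] at h1
  simp only [pairing, h0, mul_zero, add_zero, mul_one] at h1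
  exact integral_bumpTest_ne_zero (0 : Eu n) one_pos h1.symm

/-- If the packets tend to zero in a space of distributions, the pullback does not extend
continuously to a map from this space to `𝒟'^r_L`, provided that `L` misses their direction. -/
theorem not_pullbackExtends_of_tendsto {k : ℕ} (hkm : k ≤ m) (hkn : k ≤ n) {r : ℝ}
    {L : Set (Eu m × Eu m)} (hL : IsClosedConic L) {ξ₀ : Eu m} (hξ0 : ξ₀ ≠ 0)
    (hξ : ∀ i : Fin m, k ≤ (i : ℕ) → ξ₀ i = 0) (hξL : ((0 : Eu m), ξ₀) ∉ L)
    {X : Type} [TopologicalSpace X] {i : X → Distr n} {x : ℕ → X} {z : X} (hz : i z = 0)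
    (hi : ∀ J, i (x J) = ofFun (packet k (-r) (stdMap n hkm ξ₀) J))
    (hx : Tendsto x atTop (𝓝 z)) :
    ¬ PullbackExtends (stdMap n hkm) i (DSob.toDistr : DSob m r L → Distr m) := by
  rintro ⟨T, hT, hTg⟩
  obtain ⟨φ, V, δ, hV, hVc, hVL, hφ, hδ, hball⟩ := hL.exists_cone hξ0 hξL
  obtain ⟨c, hc0, hc⟩ := exists_le_locSeminorm_wave (r := r) hφ hξ0 hδ hball
  -- `T` need not be linear; its value at zero is known because the zero function is smooth.
  have hTz : (T z).toDistr = 0 := by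
    rw [hTg 0 contDiff_const z (by rw [hz, ofFun_zero])]
    exact ofFun_zero
  have hev := ((hT.tendsto z).comp hx).eventually (DSob.ball_mem_nhds (T z) hV hVc hVL hc0)
  obtain ⟨J, hJ, hJ1⟩ := (hev.and (eventually_ge_atTop 1)).exists
  have hJ' : locSeminorm r φ V ((T (x J)).toDistr - (T z).toDistr) < c := hJ
  rw [hTz, sub_zero, hTg _ (contDiff_packet k (-r) (stdMap n hkm ξ₀) J) (x J) (hi J),
    packet_comp_stdMap hkm hkn (-r) hξ hJ1] at hJ'
  exact absurd (hc J hJ1) (not_le.2 hJ')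

/-- For `a = 0` and `η = 0` the packets tend to zero while their pullbacks are all the constant `1`,
contradicting uniqueness of limits in `𝒟'`. -/
theorem not_pullbackExtends_HLoc_distr {k : ℕ} (hkm : k ≤ m) (hkn : k < n) {r : ℝ}
    (hr : r < ((n : ℝ) - k) / 2) :
    ¬ PullbackExtends (stdMap n hkm) (HLoc.toDistr : HLoc n r → Distr n)
      (id : Distr m → Distr m) := by
  rintro ⟨T, hT, hTg⟩
  have h0 : stdMap n hkm (0 : Eu m) = 0 := map_zero (stdMapCLM n hkm)
  have hkn' : (k : ℝ) < n := by exact_mod_cast hkn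
  -- With `η = 0` there are low frequencies, so negative `r` is treated through the exponent `max r
  -- 0`, still below `(n - k) / 2` because `k < n`.
  have hx : Tendsto (packetHLoc k 0 r (0 : Eu n)) atTop (𝓝 0) :=
    HLoc.tendsto_zero rfl (fun j φ => measurable_fourierLoc_packet k 0 0 j φ) fun φ =>
      tendsto_of_tendsto_of_tendsto_of_le_of_le tendsto_const_nhds
        (tendsto_locSeminorm_packet hkn.le (r := max r 0) (by simp) (Or.inl (le_max_right _ _))
          (by rw [zero_add]; exact max_lt hr (by linarith)) φ)
        (fun _ => zero_le) fun j => locSeminorm_mono_exponent (le_max_left r 0) φ _ _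
  have hT0 : T 0 = 0 := by
    have := hTg 0 contDiff_const 0 ofFun_zero.symm
    exact this.trans ofFun_zero
  have hTJ : ∀ᶠ J in atTop, T (packetHLoc k 0 r (0 : Eu n) J) = ofFun fun _ => 1 := by
    filter_upwards [eventually_ge_atTop 1] with J hJ
    have h1 := hTg _ (contDiff_packet k 0 0 J) (packetHLoc k 0 r 0 J) rfl
    refine h1.trans (congrArg ofFun ?_)
    have h2 := packet_comp_stdMap hkm hkn.le 0 (ξ₀ := (0 : Eu m)) (by simp) hJ
    rw [h0] at h2
    rw [h2]
    simp [wave]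
  have hlim := (hT.tendsto 0).comp hx
  rw [hT0] at hlim
  exact ofFun_ne_zero_of_const_one
    (tendsto_nhds_unique (tendsto_const_nhds.congr' (hTJ.mono fun _ h => h.symm)) hlim)

/-- A covector over `0` whose transpose is `η₀` padded with zeros has first `k` coordinates `η₀`,
and such covectors are excluded from `L`. -/
theorem notMem_pullbackSet_stdMap {n m k : ℕ} (hkm : k ≤ m) (hkn : k ≤ n)
    {L : Set (Eu n × Eu n)} {η₀ : Eu k}
    (h : (({0} : Set (Eu n)) ×ˢ {η : Eu n | ∀ i : Fin k, η (Fin.castLE hkn i) = η₀ i}) ∩ L = ∅) :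
    ((0 : Eu m), stdMap m le_rfl η₀) ∉ pullbackSet (stdMap n hkm) L := by
  rintro ⟨η, hη, he⟩
  rw [adjoint_fderiv_stdMap hkm hkn] at he
  have h0 : stdMap n hkm (0 : Eu m) = 0 := map_zero (stdMapCLM n hkm)
  refine Set.eq_empty_iff_forall_notMem.1 h (0, η) ⟨⟨rfl, fun i => ?_⟩, by rwa [← h0]⟩
  have h1 := stdMap_castLE (n := m) hkn hkm η i
  have h2 := stdMap_castLE (n := m) le_rfl hkm η₀ i
  rw [← h1]
  change stdMapCLM m hkn η _ = _
  rw [← he]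
  exact h2

end

end SobolevPullback

open SobolevPullback

theorem mainTheorem12 (n m k : ℕ) (hk : 1 ≤ k) (hkm : k ≤ m) (hkn : k < n) :
    (∀ r₂ : ℝ, r₂ < ((n : ℝ) - k) / 2 →
      ¬ SobolevPullback.PullbackExtends (SobolevPullback.stdMap n hkm)
        (SobolevPullback.HLoc.toDistr : SobolevPullback.HLoc n r₂ → SobolevPullback.Distr n)
        (id : SobolevPullback.Distr m → SobolevPullback.Distr m)) ∧
    (∀ (r₁ r₂ : ℝ) (L' : Set (SobolevPullback.Eu m × SobolevPullback.Eu m)),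
      r₂ - r₁ < ((n : ℝ) - k) / 2 →
      SobolevPullback.IsClosedConic L' →
      ((({0} : Set (SobolevPullback.Eu m)) ×ˢ
        ({ξ : SobolevPullback.Eu m | ∀ i : Fin m, k ≤ (i : ℕ) → ξ i = 0} \ {0})) \ L').Nonempty →
      ¬ SobolevPullback.PullbackExtends (SobolevPullback.stdMap n hkm)
        (SobolevPullback.HLoc.toDistr : SobolevPullback.HLoc n r₂ → SobolevPullback.Distr n)
        (SobolevPullback.DSob.toDistr :
          SobolevPullback.DSob m r₁ L' → SobolevPullback.Distr m)) ∧
    (∀ (r₁ r₂ : ℝ) (L : Set (SobolevPullback.Eu n × SobolevPullback.Eu n)),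
      r₂ - r₁ < ((n : ℝ) - k) / 2 →
      SobolevPullback.IsClosedConic L →
      L ∩ SobolevPullback.normals (SobolevPullback.stdMap n hkm) = ∅ →
      (∃ η₀ : SobolevPullback.Eu k, η₀ ≠ 0 ∧
        (({0} : Set (SobolevPullback.Eu n)) ×ˢ
          {η : SobolevPullback.Eu n | ∀ i : Fin k, η (Fin.castLE hkn.le i) = η₀ i}) ∩ L = ∅) →
      ¬ SobolevPullback.PullbackExtends (SobolevPullback.stdMap n hkm)
        (SobolevPullback.DSob.toDistr : SobolevPullback.DSob n r₂ L → SobolevPullback.Distr n)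
        (SobolevPullback.DSob.toDistr :
          SobolevPullback.DSob m r₁
              (SobolevPullback.pullbackSet (SobolevPullback.stdMap n hkm) L) →
            SobolevPullback.Distr m)) := by
  refine ⟨fun r₂ h => not_pullbackExtends_HLoc_distr hkm hkn h, ?_, ?_⟩
  · rintro r₁ r₂ L' h hL' ⟨⟨x, ξ₀⟩, ⟨hx, hξ, hξ0⟩, hnot⟩
    obtain rfl : x = 0 := hx
    exact not_pullbackExtends_of_tendsto hkm hkn.le hL' hξ0 hξ hnot rfl (fun _ => rfl)
      (tendsto_packetHLoc (a := -r₁) hkn.le (fun _ => stdMap_apply_of_le hkm ξ₀)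
        (Or.inr (stdMap_ne_zero hkm hkn.le hξ hξ0)) (by linarith))
  · rintro r₁ r₂ L h hL hN ⟨η₀, hη₀, hηL⟩
    have hξ0 : stdMap m le_rfl η₀ ≠ 0 :=
      stdMap_ne_zero le_rfl hkm (fun i hi => absurd i.2 (not_lt.2 hi)) hη₀
    have hξ : ∀ i : Fin m, k ≤ (i : ℕ) → stdMap m le_rfl η₀ i = 0 :=
      fun _ => stdMap_apply_of_le le_rfl η₀
    exact not_pullbackExtends_of_tendsto hkm hkn.le (isClosedConic_pullbackSet hkm hkn.le hL hN)
      hξ0 hξ (notMem_pullbackSet_stdMap hkm hkn.le hηL) rfl (fun _ => rfl)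
      (tendsto_packetDSob (a := -r₁) hkn.le L (fun _ => stdMap_apply_of_le hkm _)
        (stdMap_ne_zero hkm hkn.le hξ hξ0) (by linarith))
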